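/- Let $N$ be a (finite-dimensional, real) Lie group with Lie algebra $\mathfrak n$, and let $\mathfrak z$ be the center of $\mathfrak n$. Call $N$ 2-step nilpotent if $[[U,V],W]=0$ for all $U,V,W\in\mathfrak n$, and non-singular if moreover $\operatorname{ad}(X):\mathfrak n\to\mathfrak z$ is onto for every $X\notin\mathfrak z$. A left-invariant 2-form $\omega$ on $N$ is closed if $\omega([U,V],W)+\omega([V,W],U)+\omega([W,U],V)=0$ for all $U,V,W\in\mathfrak n$; a left-invariant symplectic structure is a closed non-degenerate left-invariant 2-form. (1) If $N$ is 2-step nilpotent and non-singular and $\dim\mathfrak n>3\dim\mathfrak z$, then every closed left-invariant 2-form on $N$ satisfies $\omega(Z,U)=0$ for all $Z\in\mathfrak z$, $U\in\mathfrak n$, and $N$ admits no left-invariant symplectic structure. (2) Say that $N$ is of type H if $\mathfrak n$ is non-abelian and 2-step nilpotent and carries an inner product such that, with $\mathfrak v=\mathfrak z^\perp$ and $j(Z):\mathfrak v\to\mathfrak v$ defined by $\langle Z,[V,W]\rangle=\langle j(Z)V,W\rangle$ for $V,W\in\mathfrak v$, the map $j(Z)$ is orthogonal for every $Z\in\mathfrak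 z$ with $\langle Z,Z\rangle=1$. Let $\mathfrak h(\mathbb C)$ be the real Lie algebra underlying the complex Heisenberg algebra, i.e. $\mathbb C^3$ with $[(x,y,z),(x',y',z')]=(0,0,xy'-yx')$. A Lie group $N$ of type H admits a left-invariant symplectic structure if and only if its Lie algebra is isomorphic to $\mathfrak h(\mathbb C)$. (3) The complex Heisenberg group, i.e. $\mathbb C^3$ with the product $(x,y,z)(x',y',z')=(x+x',y+y',z+z'+xy')$ regarded as a real Lie group, has Lie algebra isomorphic to $\mathfrak h(\mathbb C)$, is of type H, and admits a left-invariant symplectic structure. -/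

import Mathlib

open scoped Manifold ContDiff

noncomputable section

/-! ### Two-step nilpotent Lie algebras -/

section LieAlgebras

variable (L : Type*) [LieRing L] [LieAlgebra ℝ L]

/-- `L` is 2-step nilpotent: `[[U, V], W] = 0` for all `U, V, W`. -/
def IsTwoStepNilpotent : Prop :=
  ∀ U V W : L, ⁅⁅U, V⁆, W⁆ = 0

/-- `L` is non-singular: `ad X : L → 𝔷` is onto the center `𝔷` for every `X ∉ 𝔷`. -/
def IsNonsingularLie : Prop :=
  ∀ X : L, X ∉ LieAlgebra.center ℝ L → ∀ Z ∈ LieAlgebra.center ℝ L, ∃ Y : L, ⁅X, Y⁆ = Z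

variable {L}

/-- `B` is an inner product (a "metric") on `L`: symmetric and positive definite. -/
def IsMetric (B : LinearMap.BilinForm ℝ L) : Prop :=
  (∀ x y : L, B x y = B y x) ∧ ∀ x : L, x ≠ 0 → 0 < B x x

/-- `𝔳 = 𝔷^⊥`, the orthogonal complement of the center with respect to `B`. -/
def orthCenter (B : LinearMap.BilinForm ℝ L) : Submodule ℝ L :=
  B.orthogonal (LieAlgebra.center ℝ L).toSubmodule

/-- `J` is the map `j(Z) : 𝔳 → 𝔳`, implicitly defined by
`⟨Z, [V, W]⟩ = ⟨j(Z) V, W⟩` for all `V, W ∈ 𝔳`. (In finite dimension there is exactly one such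
`J` for every inner product `B` and every `Z`.) -/
def IsJMap (B : LinearMap.BilinForm ℝ L) (Z : L) (J : orthCenter B →ₗ[ℝ] orthCenter B) : Prop :=
  ∀ V W : orthCenter B, B Z ⁅(V : L), (W : L)⁆ = B (J V) W

variable (L)

/-- `L` is of type H: it is (non-abelian) 2-step nilpotent and it has an inner product such that
`j(Z) : 𝔳 → 𝔳` is orthogonal for every `Z ∈ 𝔷` with `⟨Z, Z⟩ = 1`. -/
def IsTypeH : Prop :=
  IsTwoStepNilpotent L ∧ ¬ IsLieAbelian L ∧
    ∃ B : LinearMap.BilinForm ℝ L, IsMetric B ∧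
      ∀ Z ∈ LieAlgebra.center ℝ L, B Z Z = 1 →
        ∃ J : orthCenter B →ₗ[ℝ] orthCenter B, IsJMap B Z J ∧
          ∀ V W : orthCenter B, B (J V) (J W) = B V W

end LieAlgebras

/-! ### Lie groups and left-invariant 2-forms -/

instance instLEInftyMinSmoothnessReal : ENat.LEInfty (minSmoothness ℝ 3) :=
  ⟨by rw [minSmoothness_of_isRCLikeNormedField]; exact ENat.LEInfty.out⟩

section LieGroups

variable (E : Type*) [NormedAddCommGroup E] [NormedSpace ℝ E]
  (N : Type*) [TopologicalSpace N] [ChartedSpace E N] [Group N]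

/-- A left-invariant 2-form on a Lie group `N` modelled on `E`: an alternating bilinear form on
every tangent space, preserved by the differentials of all left translations. -/
structure LeftInvariantTwoForm where
  /-- the value of the form at a point of the group -/
  form : ∀ g : N, TangentSpace 𝓘(ℝ, E) g →ₗ[ℝ] TangentSpace 𝓘(ℝ, E) g →ₗ[ℝ] ℝ
  alternating : ∀ (g : N) (v : TangentSpace 𝓘(ℝ, E) g), form g v v = 0
  left_invariant : ∀ (g h : N) (v w : TangentSpace 𝓘(ℝ, E) h),
    form (g * h) (mfderiv 𝓘(ℝ, E) 𝓘(ℝ, E) (fun x : N => g * x) h v)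
      (mfderiv 𝓘(ℝ, E) 𝓘(ℝ, E) (fun x : N => g * x) h w) = form h v w

variable {E N}

/-- A left-invariant 2-form is closed if its value at the identity satisfies
`Ω([U, V], W) + Ω([V, W], U) + Ω([W, U], V) = 0` for all `U, V, W` in the Lie algebra. -/
def LeftInvariantTwoForm.IsClosed (Ω : LeftInvariantTwoForm E N) : Prop :=
  ∀ U V W : GroupLieAlgebra 𝓘(ℝ, E) N,
    Ω.form 1 ⁅U, V⁆ W + Ω.form 1 ⁅V, W⁆ U + Ω.form 1 ⁅W, U⁆ V = 0

/-- Non-degeneracy at every point of the group. -/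
def LeftInvariantTwoForm.IsNondegenerate (Ω : LeftInvariantTwoForm E N) : Prop :=
  ∀ (g : N) (u : TangentSpace 𝓘(ℝ, E) g),
    (∀ v : TangentSpace 𝓘(ℝ, E) g, Ω.form g u v = 0) → u = 0

variable (E N)

/-- `N` admits a left-invariant symplectic structure: a closed non-degenerate left-invariant
2-form. -/
def AdmitsLeftInvariantSymplectic : Prop :=
  ∃ Ω : LeftInvariantTwoForm E N, Ω.IsClosed ∧ Ω.IsNondegenerate

end LieGroups

/-! ### The complex Heisenberg algebra and group -/

/-- The underlying real Lie algebra of the complex Heisenberg algebra: `ℂ³` with the bracket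
`[(x, y, z), (x', y', z')] = (0, 0, x y' - y x')`. -/
def ComplexHeisenbergAlgebra : Type := ℂ × ℂ × ℂ

namespace ComplexHeisenbergAlgebra

instance : AddCommGroup ComplexHeisenbergAlgebra := inferInstanceAs (AddCommGroup (ℂ × ℂ × ℂ))

instance : Module ℝ ComplexHeisenbergAlgebra := inferInstanceAs (Module ℝ (ℂ × ℂ × ℂ))

instance : Bracket ComplexHeisenbergAlgebra ComplexHeisenbergAlgebra where
  bracket a b := ((0, 0, a.1 * b.2.1 - a.2.1 * b.1) : ℂ × ℂ × ℂ)

theorem ext_iff_coords {a b : ComplexHeisenbergAlgebra} :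
    a = b ↔ a.1 = b.1 ∧ a.2.1 = b.2.1 ∧ a.2.2 = b.2.2 :=
  ⟨fun h => by subst h; exact ⟨rfl, rfl, rfl⟩,
    fun h => Prod.ext h.1 (Prod.ext h.2.1 h.2.2)⟩

theorem bracket_x (a b : ComplexHeisenbergAlgebra) : (⁅a, b⁆).1 = 0 := rfl

theorem bracket_y (a b : ComplexHeisenbergAlgebra) : (⁅a, b⁆).2.1 = 0 := rfl

theorem bracket_z (a b : ComplexHeisenbergAlgebra) :
    (⁅a, b⁆).2.2 = a.1 * b.2.1 - a.2.1 * b.1 := rfl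

theorem zero_x : (0 : ComplexHeisenbergAlgebra).1 = 0 := rfl

theorem zero_y : (0 : ComplexHeisenbergAlgebra).2.1 = 0 := rfl

theorem zero_z : (0 : ComplexHeisenbergAlgebra).2.2 = 0 := rfl

theorem add_x (a b : ComplexHeisenbergAlgebra) : (a + b).1 = a.1 + b.1 := rfl

theorem add_y (a b : ComplexHeisenbergAlgebra) : (a + b).2.1 = a.2.1 + b.2.1 := rfl

theorem add_z (a b : ComplexHeisenbergAlgebra) : (a + b).2.2 = a.2.2 + b.2.2 := rfl

theorem smul_x (t : ℝ) (a : ComplexHeisenbergAlgebra) : (t • a).1 = (t : ℂ) * a.1 := rfl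

theorem smul_y (t : ℝ) (a : ComplexHeisenbergAlgebra) : (t • a).2.1 = (t : ℂ) * a.2.1 := rfl

theorem smul_z (t : ℝ) (a : ComplexHeisenbergAlgebra) : (t • a).2.2 = (t : ℂ) * a.2.2 := rfl

instance : LieRing ComplexHeisenbergAlgebra where
  add_lie a b c := by
    rw [ext_iff_coords]
    simp only [bracket_x, bracket_y, bracket_z, add_x, add_y, add_z]
    refine ⟨?_, ?_, ?_⟩ <;> ring
  lie_add a b c := by
    rw [ext_iff_coords]
    simp only [bracket_x, bracket_y, bracket_z, add_x, add_y, add_z]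
    refine ⟨?_, ?_, ?_⟩ <;> ring
  lie_self a :=
    ext_iff_coords.2 ⟨rfl, rfl, by rw [bracket_z, zero_z]; ring⟩
  leibniz_lie a b c := by
    rw [ext_iff_coords]
    simp only [bracket_x, bracket_y, bracket_z, add_x, add_y, add_z]
    refine ⟨?_, ?_, ?_⟩ <;> ring

instance : LieAlgebra ℝ ComplexHeisenbergAlgebra where
  lie_smul t a b := by
    rw [ext_iff_coords]
    simp only [bracket_x, bracket_y, bracket_z, smul_x, smul_y, smul_z]
    refine ⟨?_, ?_, ?_⟩ <;> ring

end ComplexHeisenbergAlgebra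

/-- The complex Heisenberg group: `ℂ³` with the product
`(x, y, z) (x', y', z') = (x + x', y + y', z + z' + x y')`, i.e. the group of upper triangular
complex `3 × 3` matrices with ones on the diagonal, regarded as a real Lie group. -/
def ComplexHeisenbergGroup : Type := ℂ × ℂ × ℂ

namespace ComplexHeisenbergGroup

instance : TopologicalSpace ComplexHeisenbergGroup :=
  inferInstanceAs (TopologicalSpace (ℂ × ℂ × ℂ))

instance : ChartedSpace (ℂ × ℂ × ℂ) ComplexHeisenbergGroup :=
  inferInstanceAs (ChartedSpace (ℂ × ℂ × ℂ) (ℂ × ℂ × ℂ))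

instance : Mul ComplexHeisenbergGroup where
  mul a b := ((a.1 + b.1, a.2.1 + b.2.1, a.2.2 + b.2.2 + a.1 * b.2.1) : ℂ × ℂ × ℂ)

instance : One ComplexHeisenbergGroup where
  one := ((0, 0, 0) : ℂ × ℂ × ℂ)

instance : Inv ComplexHeisenbergGroup where
  inv a := ((-a.1, -a.2.1, -a.2.2 + a.1 * a.2.1) : ℂ × ℂ × ℂ)

theorem ext_iff_coords {a b : ComplexHeisenbergGroup} :
    a = b ↔ a.1 = b.1 ∧ a.2.1 = b.2.1 ∧ a.2.2 = b.2.2 :=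
  ⟨fun h => by subst h; exact ⟨rfl, rfl, rfl⟩,
    fun h => Prod.ext h.1 (Prod.ext h.2.1 h.2.2)⟩

theorem mul_x (a b : ComplexHeisenbergGroup) : (a * b).1 = a.1 + b.1 := rfl

theorem mul_y (a b : ComplexHeisenbergGroup) : (a * b).2.1 = a.2.1 + b.2.1 := rfl

theorem mul_z (a b : ComplexHeisenbergGroup) :
    (a * b).2.2 = a.2.2 + b.2.2 + a.1 * b.2.1 := rfl

theorem one_x : (1 : ComplexHeisenbergGroup).1 = 0 := rfl

theorem one_y : (1 : ComplexHeisenbergGroup).2.1 = 0 := rfl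

theorem one_z : (1 : ComplexHeisenbergGroup).2.2 = 0 := rfl

theorem inv_x (a : ComplexHeisenbergGroup) : (a⁻¹).1 = -a.1 := rfl

theorem inv_y (a : ComplexHeisenbergGroup) : (a⁻¹).2.1 = -a.2.1 := rfl

theorem inv_z (a : ComplexHeisenbergGroup) : (a⁻¹).2.2 = -a.2.2 + a.1 * a.2.1 := rfl

instance : Group ComplexHeisenbergGroup :=
  Group.ofLeftAxioms
    (fun a b c => by
      rw [ext_iff_coords]
      simp only [mul_x, mul_y, mul_z]
      refine ⟨?_, ?_, ?_⟩ <;> ring)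
    (fun a => by
      rw [ext_iff_coords]
      simp only [mul_x, mul_y, mul_z, one_x, one_y, one_z]
      refine ⟨?_, ?_, ?_⟩ <;> ring)
    (fun a => by
      rw [ext_iff_coords]
      simp only [mul_x, mul_y, mul_z, one_x, one_y, one_z, inv_x, inv_y, inv_z]
      refine ⟨?_, ?_, ?_⟩ <;> ring)

theorem contDiff_mul_aux : ContDiff ℝ ∞ (fun p : (ℂ × ℂ × ℂ) × (ℂ × ℂ × ℂ) =>
    ((p.1.1 + p.2.1, p.1.2.1 + p.2.2.1, p.1.2.2 + p.2.2.2 + p.1.1 * p.2.2.1) : ℂ × ℂ × ℂ)) := by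
  fun_prop

theorem contDiff_inv_aux : ContDiff ℝ ∞ (fun a : ℂ × ℂ × ℂ =>
    ((-a.1, -a.2.1, -a.2.2 + a.1 * a.2.1) : ℂ × ℂ × ℂ)) := by
  fun_prop

instance : IsManifold 𝓘(ℝ, ℂ × ℂ × ℂ) ∞ ComplexHeisenbergGroup :=
  inferInstanceAs (IsManifold 𝓘(ℝ, ℂ × ℂ × ℂ) ∞ (ℂ × ℂ × ℂ))

instance : LieGroup 𝓘(ℝ, ℂ × ℂ × ℂ) ∞ ComplexHeisenbergGroup where
  contMDiff_mul := by
    have h := contDiff_mul_aux.contMDiff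
    rw [modelWithCornersSelf_prod, ← chartedSpaceSelf_prod] at h
    exact h
  contMDiff_inv := contDiff_inv_aux.contMDiff

end ComplexHeisenbergGroup

end

/-! A left-invariant form is determined by its value at the identity
(`admitsLeftInvariantSymplectic_iff`), so everything is linear algebra on 𝔫.

Non-singular case: closedness makes 𝔷 isotropic. If dim 𝔫 > 3 dim 𝔷, each U commutes with some
non-central V that is ω-orthogonal to 𝔷. Writing Z = [V, W], closedness reduces to ω(Z, U) = 0, so 𝔷
lies in the radical of ω.

Type H: the maps j(Z) form a Clifford action on 𝔳, and 𝔷 is again isotropic, so ω pairs 𝔷 with 𝔳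
through a surjection S : 𝔳 → 𝔷. Closedness becomes a cyclic identity between j and S. Let K = ker S
and let R be the section of S with values in Kᗮ. For u in K, j(𝔷)u = Kᗮ when u ≠ 0, and P_u z =
R†(j(z)u) is symmetric, with P_u² = |u|² R†R; hence P_u and P_v anticommute when u ⟂ v. On
eigenvectors of P_u the cyclic identity becomes (a₁a₂ + a₂a₃ + a₃a₁)⟨j(z₁)j(z₂)u, j(z₃)u⟩ = 0
(`triple_eigenvectors`). Taking for a₁ an eigenvalue of least absolute value keeps the scalar
nonzero often enough to place many vectors j(z₁)j(z₂)u in K. Counting dimensions, with the parity of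
dim 𝔫, gives dim 𝔷 = 2 and dim 𝔳 = 4 (`finrank_of_even`). A Clifford action in these dimensions is
unique up to isomorphism and gives 𝔥(ℂ) (`exists_heisenberg_equiv`).

Conversely, 𝔥(ℂ) carries an explicit symplectic form and an explicit metric of type H. -/

noncomputable section

/-- A symplectic form on a real Lie algebra. -/
structure IsSymplecticForm {L : Type*} [LieRing L] [LieAlgebra ℝ L]
    (σ : L →ₗ[ℝ] L →ₗ[ℝ] ℝ) : Prop where
  alternating : ∀ v, σ v v = 0
  closed : ∀ U V W, σ ⁅U, V⁆ W + σ ⁅V, W⁆ U + σ ⁅W, U⁆ V = 0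
  nondegenerate : ∀ u, (∀ v, σ u v = 0) → u = 0

theorem IsSymplecticForm.comp {L L' : Type*} [LieRing L] [LieAlgebra ℝ L] [LieRing L']
    [LieAlgebra ℝ L'] {σ : L →ₗ[ℝ] L →ₗ[ℝ] ℝ} (h : IsSymplecticForm σ) (e : L' ≃ₗ⁅ℝ⁆ L) :
    IsSymplecticForm (σ.compl₁₂ (e : L' →ₗ[ℝ] L) (e : L' →ₗ[ℝ] L)) where
  alternating v := by simpa using h.alternating (e v)
  closed U V W := by
    have := h.closed (e U) (e V) (e W)
    simp only [← LieEquiv.map_lie] at this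
    exact this
  nondegenerate u hu := by
    have : e u = 0 := h.nondegenerate _ fun v => by simpa using hu (e.symm v)
    simpa using this

/-! ### Left-invariant forms and their values at the identity -/

section LieGroup

variable {E : Type*} [NormedAddCommGroup E] [NormedSpace ℝ E]
  {N : Type*} [TopologicalSpace N] [ChartedSpace E N] [Group N]

/-- The differential at `g` of the left translation by `g⁻¹`, as a map to the Lie algebra. -/
def maurerCartan (g : N) : TangentSpace 𝓘(ℝ, E) g →ₗ[ℝ] GroupLieAlgebra 𝓘(ℝ, E) N :=
  (mfderiv 𝓘(ℝ, E) 𝓘(ℝ, E) (fun x : N => g⁻¹ * x) g).toLinearMap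

theorem maurerCartan_one (v : TangentSpace 𝓘(ℝ, E) (1 : N)) : maurerCartan (1 : N) v = v := by
  have : (fun x : N => (1 : N)⁻¹ * x) = id := by ext; simp
  simp only [maurerCartan]
  rw [this, mfderiv_id]
  rfl

variable [LieGroup 𝓘(ℝ, E) ∞ N]

theorem mdifferentiableAt_mul_left_real (g h : N) :
    MDifferentiableAt 𝓘(ℝ, E) 𝓘(ℝ, E) (fun x : N => g * x) h :=
  (contMDiff_mul_left (I := 𝓘(ℝ, E)) (n := ∞)).contMDiffAt.mdifferentiableAt (by simp)

theorem mfderiv_mul_left_mul (a g h : N) (v : TangentSpace 𝓘(ℝ, E) h) :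
    mfderiv 𝓘(ℝ, E) 𝓘(ℝ, E) (fun x : N => a * x) (g * h)
      (mfderiv 𝓘(ℝ, E) 𝓘(ℝ, E) (fun x : N => g * x) h v) =
    mfderiv 𝓘(ℝ, E) 𝓘(ℝ, E) (fun x : N => a * g * x) h v := by
  have : (fun x : N => a * g * x) = (fun x : N => a * x) ∘ (fun x : N => g * x) := by
    ext x; simp [mul_assoc]
  rw [this, mfderiv_comp (I' := 𝓘(ℝ, E)) h (mdifferentiableAt_mul_left_real a (g * h))
    (mdifferentiableAt_mul_left_real g h)]
  rfl

/-- Chain rule together with (gh)⁻¹g = h⁻¹. This is the left-invariance of any form pulled back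
along `maurerCartan`. -/
theorem maurerCartan_mul (g h : N) (v : TangentSpace 𝓘(ℝ, E) h) :
    maurerCartan (g * h) (mfderiv 𝓘(ℝ, E) 𝓘(ℝ, E) (fun x : N => g * x) h v) =
      maurerCartan h v := by
  have := mfderiv_mul_left_mul (E := E) (g * h)⁻¹ g h v
  have e : (g * h)⁻¹ * g = h⁻¹ := by group
  rw [e] at this
  exact this

/-- The left-invariant 2-form with prescribed alternating value at the identity. -/
def LeftInvariantTwoForm.ofAlternating (σ : GroupLieAlgebra 𝓘(ℝ, E) N →ₗ[ℝ]
    GroupLieAlgebra 𝓘(ℝ, E) N →ₗ[ℝ] ℝ) (hσ : ∀ v, σ v v = 0) : LeftInvariantTwoForm E N where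
  form g := σ.compl₁₂ (maurerCartan g) (maurerCartan g)
  alternating g v := hσ _
  left_invariant g h v w := by
    simp only [LinearMap.compl₁₂_apply]
    rw [maurerCartan_mul, maurerCartan_mul]

theorem LeftInvariantTwoForm.ofAlternating_one (σ : GroupLieAlgebra 𝓘(ℝ, E) N →ₗ[ℝ]
    GroupLieAlgebra 𝓘(ℝ, E) N →ₗ[ℝ] ℝ) (hσ : ∀ v, σ v v = 0) :
    (LeftInvariantTwoForm.ofAlternating σ hσ).form 1 = σ := by
  ext v w
  simp only [ofAlternating, LinearMap.compl₁₂_apply]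
  rw [maurerCartan_one, maurerCartan_one]

theorem eq_zero_of_maurerCartan_eq_zero (g : N) (u : TangentSpace 𝓘(ℝ, E) g)
    (h : maurerCartan g u = 0) : u = 0 := by
  have := mfderiv_mul_left_mul (E := E) g g⁻¹ g u
  have h' : mfderiv 𝓘(ℝ, E) 𝓘(ℝ, E) (fun x : N => g⁻¹ * x) g u = 0 := h
  rw [h', map_zero] at this
  have e : (fun x : N => g * g⁻¹ * x) = id := by ext; simp
  rw [e, mfderiv_id] at this
  exact this.symm

theorem maurerCartan_surjective (g : N) :
    Function.Surjective (maurerCartan (E := E) g) := by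
  intro v
  have h := (maurerCartan_mul (E := E) g 1 v).trans (maurerCartan_one v)
  rw [mul_one] at h
  exact ⟨_, h⟩

theorem LeftInvariantTwoForm.isNondegenerate_ofAlternating (σ : GroupLieAlgebra 𝓘(ℝ, E) N →ₗ[ℝ]
    GroupLieAlgebra 𝓘(ℝ, E) N →ₗ[ℝ] ℝ) (hσ : ∀ v, σ v v = 0)
    (h : ∀ u, (∀ v, σ u v = 0) → u = 0) :
    (LeftInvariantTwoForm.ofAlternating σ hσ).IsNondegenerate := by
  intro g u hu
  refine eq_zero_of_maurerCartan_eq_zero g u (h _ fun v => ?_)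
  obtain ⟨w, rfl⟩ := maurerCartan_surjective g v
  exact hu w

theorem admitsLeftInvariantSymplectic_iff [FiniteDimensional ℝ E] :
    AdmitsLeftInvariantSymplectic E N ↔ ∃ σ : GroupLieAlgebra 𝓘(ℝ, E) N →ₗ[ℝ]
      GroupLieAlgebra 𝓘(ℝ, E) N →ₗ[ℝ] ℝ, IsSymplecticForm (L := GroupLieAlgebra 𝓘(ℝ, E) N) σ := by
  constructor
  · rintro ⟨Ω, hc, hn⟩
    exact ⟨Ω.form 1, Ω.alternating 1, hc, hn 1⟩
  · rintro ⟨σ, hσ⟩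
    refine ⟨LeftInvariantTwoForm.ofAlternating σ hσ.alternating, ?_, ?_⟩
    · intro U V W
      rw [LeftInvariantTwoForm.ofAlternating_one]
      exact hσ.closed U V W
    · exact LeftInvariantTwoForm.isNondegenerate_ofAlternating σ _ hσ.nondegenerate

end LieGroup

/-! ### The Lie algebra of the complex Heisenberg group -/

theorem ComplexHeisenbergGroup.hasFDerivAt_mul_left (g h : ℂ × ℂ × ℂ) :
    HasFDerivAt (fun x : ℂ × ℂ × ℂ => ((g.1 + x.1, g.2.1 + x.2.1, g.2.2 + x.2.2 + g.1 * x.2.1) :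
      ℂ × ℂ × ℂ))
      ((ContinuousLinearMap.fst ℝ ℂ (ℂ × ℂ)).prod
        (((ContinuousLinearMap.fst ℝ ℂ ℂ).comp (ContinuousLinearMap.snd ℝ ℂ (ℂ × ℂ))).prod
          ((ContinuousLinearMap.snd ℝ ℂ ℂ).comp (ContinuousLinearMap.snd ℝ ℂ (ℂ × ℂ)) +
            g.1 • (ContinuousLinearMap.fst ℝ ℂ ℂ).comp (ContinuousLinearMap.snd ℝ ℂ (ℂ × ℂ))))) h := by
  have h1 : HasFDerivAt (fun x : ℂ × ℂ × ℂ => x.1) (ContinuousLinearMap.fst ℝ ℂ (ℂ × ℂ)) h :=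
    hasFDerivAt_fst
  have h2 : HasFDerivAt (fun x : ℂ × ℂ × ℂ => x.2.1)
    ((ContinuousLinearMap.fst ℝ ℂ ℂ).comp (ContinuousLinearMap.snd ℝ ℂ (ℂ × ℂ))) h :=
    HasFDerivAt.comp (g := fun y : ℂ × ℂ => y.1) h hasFDerivAt_fst hasFDerivAt_snd
  have h3 : HasFDerivAt (fun x : ℂ × ℂ × ℂ => x.2.2)
    ((ContinuousLinearMap.snd ℝ ℂ ℂ).comp (ContinuousLinearMap.snd ℝ ℂ (ℂ × ℂ))) h :=
    HasFDerivAt.comp (g := fun y : ℂ × ℂ => y.2) h hasFDerivAt_snd hasFDerivAt_snd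
  exact (h1.const_add _).prodMk ((h2.const_add _).prodMk ((h3.const_add _).add (h2.const_mul _)))

theorem ComplexHeisenbergGroup.mulInvariantVectorField_eq (v : ℂ × ℂ × ℂ) :
    mulInvariantVectorField (I := 𝓘(ℝ, ℂ × ℂ × ℂ)) (G := ComplexHeisenbergGroup) v =
      fun g => ((v.1, v.2.1, v.2.2 + g.1 * v.2.1) : ℂ × ℂ × ℂ) := by
  ext1 g
  have h := (ComplexHeisenbergGroup.hasFDerivAt_mul_left g (0, 0, 0)).hasMFDerivAt.mfderiv
  exact congrArg (fun T : (ℂ × ℂ × ℂ) →L[ℝ] (ℂ × ℂ × ℂ) => T v) h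

theorem ComplexHeisenbergGroup.bracket_eq
    (v w : GroupLieAlgebra 𝓘(ℝ, ℂ × ℂ × ℂ) ComplexHeisenbergGroup) :
    ⁅v, w⁆ = ((0, 0, v.1 * w.2.1 - v.2.1 * w.1) : ℂ × ℂ × ℂ) := by
  have key : ∀ v w : ℂ × ℂ × ℂ, VectorField.mlieBracket 𝓘(ℝ, ℂ × ℂ × ℂ)
      (fun g : ℂ × ℂ × ℂ => ((v.1, v.2.1, v.2.2 + g.1 * v.2.1) : ℂ × ℂ × ℂ))
      (fun g : ℂ × ℂ × ℂ => ((w.1, w.2.1, w.2.2 + g.1 * w.2.1) : ℂ × ℂ × ℂ)) (0, 0, 0) =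
      ((0, 0, v.1 * w.2.1 - v.2.1 * w.1) : ℂ × ℂ × ℂ) := by
    intro v w
    have hd : ∀ v : ℂ × ℂ × ℂ, HasFDerivAt
        (fun g : ℂ × ℂ × ℂ => ((v.1, v.2.1, v.2.2 + g.1 * v.2.1) : ℂ × ℂ × ℂ))
        ((0 : (ℂ × ℂ × ℂ) →L[ℝ] ℂ).prod ((0 : (ℂ × ℂ × ℂ) →L[ℝ] ℂ).prod
          (v.2.1 • ContinuousLinearMap.fst ℝ ℂ (ℂ × ℂ)))) (0, 0, 0) := by
      intro v
      have h1 : HasFDerivAt (fun x : ℂ × ℂ × ℂ => x.1) (ContinuousLinearMap.fst ℝ ℂ (ℂ × ℂ))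
        (0, 0, 0) := hasFDerivAt_fst
      exact (hasFDerivAt_const _ _).prodMk ((hasFDerivAt_const _ _).prodMk
        ((h1.mul_const _).const_add _))
    -- On the model space itself the manifold bracket is the vector space bracket Dw(v) - Dv(w);
    -- only the last coordinates of the fields are non-constant.
    refine (congrFun ((VectorField.mlieBracketWithin_univ (I := 𝓘(ℝ, ℂ × ℂ × ℂ))).symm.trans
      (VectorField.mlieBracketWithin_eq_lieBracketWithin.trans
        VectorField.lieBracketWithin_univ)) _).trans ?_
    rw [VectorField.lieBracket_eq]
    simp only [(hd v).fderiv, (hd w).fderiv]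
    refine Prod.ext ?_ (Prod.ext ?_ ?_)
    · simp
    · simp
    · simp; ring
  have hv := ComplexHeisenbergGroup.mulInvariantVectorField_eq v
  have hw := ComplexHeisenbergGroup.mulInvariantVectorField_eq w
  rw [GroupLieAlgebra.bracket_def]
  erw [hv, hw]
  exact key v w

/-- The Lie algebra of the complex Heisenberg group is the complex Heisenberg algebra. -/
def ComplexHeisenbergGroup.lieEquiv :
    GroupLieAlgebra 𝓘(ℝ, ℂ × ℂ × ℂ) ComplexHeisenbergGroup ≃ₗ⁅ℝ⁆ ComplexHeisenbergAlgebra where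
  toFun v := v
  invFun v := v
  map_add' _ _ := rfl
  map_smul' _ _ := rfl
  map_lie' {v w} := ComplexHeisenbergGroup.bracket_eq v w
  left_inv _ := rfl
  right_inv _ := rfl

/-! ### Type H metric and symplectic form on 𝔥(ℂ) -/

namespace ComplexHeisenbergAlgebra

/-- The element with given coordinates. -/
def mk (x y z : ℂ) : ComplexHeisenbergAlgebra := (x, y, z)

theorem mk_x (x y z : ℂ) : (mk x y z).1 = x := rfl

theorem mk_y (x y z : ℂ) : (mk x y z).2.1 = y := rfl

theorem mk_z (x y z : ℂ) : (mk x y z).2.2 = z := rfl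

theorem mem_center_iff (a : ComplexHeisenbergAlgebra) :
    a ∈ LieAlgebra.center ℝ ComplexHeisenbergAlgebra ↔ a.1 = 0 ∧ a.2.1 = 0 := by
  rw [LieModule.mem_maxTrivSubmodule]
  constructor
  · intro h
    constructor
    · have := (ext_iff_coords.1 (h (mk 0 1 0))).2.2
      rw [bracket_z] at this
      simpa [zero_z, mk_x, mk_y] using this
    · have := (ext_iff_coords.1 (h (mk 1 0 0))).2.2
      rw [bracket_z] at this
      simpa [zero_z, mk_x, mk_y] using this
  · rintro ⟨h1, h2⟩ b
    rw [ext_iff_coords, bracket_z, h1, h2]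
    exact ⟨rfl, rfl, by rw [zero_z]; ring⟩

theorem isTwoStepNilpotent : IsTwoStepNilpotent ComplexHeisenbergAlgebra := by
  intro U V W
  rw [ext_iff_coords]
  exact ⟨rfl, rfl, by rw [bracket_z, bracket_x, bracket_y, zero_z]; ring⟩

theorem not_isLieAbelian : ¬ IsLieAbelian ComplexHeisenbergAlgebra := by
  intro h
  have := (ext_iff_coords.1 (h.trivial (mk 1 0 0) (mk 0 1 0))).2.2
  rw [bracket_z] at this
  simp [zero_z, mk_x, mk_y] at this

/-- The standard inner product. -/
def metric : LinearMap.BilinForm ℝ ComplexHeisenbergAlgebra :=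
  LinearMap.mk₂ ℝ (fun a b => a.1.re * b.1.re + a.1.im * b.1.im + (a.2.1.re * b.2.1.re +
      a.2.1.im * b.2.1.im) + (a.2.2.re * b.2.2.re + a.2.2.im * b.2.2.im))
    (fun a b c => by simp only [add_x, add_y, add_z, Complex.add_re, Complex.add_im]; ring)
    (fun t a b => by
      simp only [smul_x, smul_y, smul_z, Complex.re_ofReal_mul, Complex.im_ofReal_mul, smul_eq_mul]
      ring)
    (fun a b c => by simp only [add_x, add_y, add_z, Complex.add_re, Complex.add_im]; ring)
    (fun t a b => by
      simp only [smul_x, smul_y, smul_z, Complex.re_ofReal_mul, Complex.im_ofReal_mul, smul_eq_mul]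
      ring)

theorem metric_apply (a b : ComplexHeisenbergAlgebra) :
    metric a b = a.1.re * b.1.re + a.1.im * b.1.im + (a.2.1.re * b.2.1.re +
      a.2.1.im * b.2.1.im) + (a.2.2.re * b.2.2.re + a.2.2.im * b.2.2.im) := rfl

theorem isMetric_metric : IsMetric metric := by
  constructor
  · intro a b
    simp only [metric_apply]
    ring
  · intro a ha
    rw [metric_apply]
    by_contra! h
    apply ha
    rw [ext_iff_coords, zero_x, zero_y, zero_z]
    refine ⟨Complex.ext ?_ ?_, Complex.ext ?_ ?_, Complex.ext ?_ ?_⟩ <;>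
    · simp only [Complex.zero_re, Complex.zero_im]
      nlinarith [sq_nonneg a.1.re, sq_nonneg a.1.im, sq_nonneg a.2.1.re, sq_nonneg a.2.1.im,
        sq_nonneg a.2.2.re, sq_nonneg a.2.2.im]

theorem mem_orthCenter_metric_iff (a : ComplexHeisenbergAlgebra) :
    a ∈ orthCenter metric ↔ a.2.2 = 0 := by
  rw [orthCenter, LinearMap.BilinForm.mem_orthogonal_iff]
  constructor
  · intro h
    have := h (mk 0 0 a.2.2) ((mem_center_iff _).2 ⟨rfl, rfl⟩)
    rw [metric_apply] at this
    simp only [mk_x, mk_y, mk_z, Complex.zero_re, Complex.zero_im] at this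
    refine Complex.ext ?_ ?_ <;>
    · simp only [Complex.zero_re, Complex.zero_im]
      nlinarith [sq_nonneg a.2.2.re, sq_nonneg a.2.2.im]
  · rintro h b hb
    obtain ⟨h1, h2⟩ := (mem_center_iff _).1 hb
    rw [metric_apply, h, h1, h2]
    simp

/-- The complex structure `(x, y, 0) ↦ (- c * conj y, c * conj x, 0)` for `|c| = 1`. -/
def jMap (c : ℂ) : orthCenter metric →ₗ[ℝ] orthCenter metric where
  toFun a := ⟨mk (-(c * starRingEnd ℂ a.1.2.1)) (c * starRingEnd ℂ a.1.1) 0,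
    (mem_orthCenter_metric_iff _).2 rfl⟩
  map_add' a b := by
    apply Subtype.ext
    rw [ext_iff_coords]
    simp only [Submodule.coe_add, add_x, add_y, add_z, mk_x, mk_y, mk_z, map_add]
    refine ⟨?_, ?_, ?_⟩ <;> ring
  map_smul' t a := by
    apply Subtype.ext
    rw [ext_iff_coords]
    simp only [Submodule.coe_smul, smul_x, smul_y, smul_z, mk_x, mk_y, mk_z, map_mul, Complex.conj_ofReal,
      RingHom.id_apply]
    refine ⟨?_, ?_, ?_⟩ <;> ring

theorem coe_jMap (c : ℂ) (a : orthCenter metric) :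
    (jMap c a : ComplexHeisenbergAlgebra) =
      mk (-(c * starRingEnd ℂ a.1.2.1)) (c * starRingEnd ℂ a.1.1) 0 := rfl

theorem isTypeH : IsTypeH ComplexHeisenbergAlgebra := by
  refine ⟨isTwoStepNilpotent, not_isLieAbelian, metric, isMetric_metric, fun Z hZ h1 => ?_⟩
  obtain ⟨hx, hy⟩ := (mem_center_iff _).1 hZ
  refine ⟨jMap Z.2.2, fun V W => ?_, fun V W => ?_⟩
  · have hW := (mem_orthCenter_metric_iff _).1 W.2
    simp only [metric_apply, bracket_x, bracket_y, bracket_z, coe_jMap, mk_x, mk_y, mk_z, hx, hy, hW,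
      Complex.zero_re, Complex.zero_im, Complex.mul_re, Complex.mul_im, Complex.sub_re,
      Complex.sub_im, Complex.conj_re, Complex.conj_im, Complex.neg_re, Complex.neg_im]
    ring
  · have hV := (mem_orthCenter_metric_iff _).1 V.2
    have hW := (mem_orthCenter_metric_iff _).1 W.2
    change metric _ _ = metric _ _
    rw [metric_apply, hx, hy] at h1
    simp only [metric_apply, coe_jMap, mk_x, mk_y, mk_z, hV, hW,
      Complex.zero_re, Complex.zero_im, Complex.mul_re, Complex.mul_im,
      Complex.conj_re, Complex.conj_im, Complex.neg_re, Complex.neg_im] at h1 ⊢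
    -- The left side is |c|²⟨V, W⟩ with c the central coordinate of Z, and `h1` says |c|² = 1.
    linear_combination ((V : ComplexHeisenbergAlgebra).1.re * (W : ComplexHeisenbergAlgebra).1.re +
      (V : ComplexHeisenbergAlgebra).1.im * (W : ComplexHeisenbergAlgebra).1.im +
      (V : ComplexHeisenbergAlgebra).2.1.re * (W : ComplexHeisenbergAlgebra).2.1.re +
      (V : ComplexHeisenbergAlgebra).2.1.im * (W : ComplexHeisenbergAlgebra).2.1.im) * h1

/-- A symplectic form on the complex Heisenberg algebra. -/
def symplecticForm : ComplexHeisenbergAlgebra →ₗ[ℝ] ComplexHeisenbergAlgebra →ₗ[ℝ] ℝ :=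
  LinearMap.mk₂ ℝ (fun a b => (a.2.2 * b.1 - a.1 * b.2.2).re +
      (a.2.1.re * b.2.1.im - a.2.1.im * b.2.1.re))
    (fun a b c => by
      simp only [add_x, add_y, add_z, Complex.add_re, Complex.add_im, Complex.sub_re,
        Complex.mul_re]
      ring)
    (fun t a b => by
      simp only [smul_x, smul_y, smul_z, Complex.im_ofReal_mul, smul_eq_mul,
        Complex.ofReal_re, Complex.ofReal_im, Complex.sub_re, Complex.mul_re]
      ring)
    (fun a b c => by
      simp only [add_x, add_y, add_z, Complex.add_re, Complex.add_im, Complex.sub_re,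
        Complex.mul_re]
      ring)
    (fun t a b => by
      simp only [smul_x, smul_y, smul_z, Complex.im_ofReal_mul, smul_eq_mul,
        Complex.ofReal_re, Complex.ofReal_im, Complex.sub_re, Complex.mul_re]
      ring)

theorem symplecticForm_apply (a b : ComplexHeisenbergAlgebra) :
    symplecticForm a b = (a.2.2 * b.1 - a.1 * b.2.2).re +
      (a.2.1.re * b.2.1.im - a.2.1.im * b.2.1.re) := rfl

/-- The x- and z-lines are dual under Re(zx' - xz'), and the y-line carries its own real area form.
Brackets have no y-part, and the cyclic sum of Re((xy' - yx')x'') cancels. -/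
theorem isSymplecticForm_symplecticForm : IsSymplecticForm symplecticForm where
  alternating v := by
    rw [symplecticForm_apply, mul_comm v.1, mul_comm v.2.1.re]
    simp
  closed U V W := by
    simp only [symplecticForm_apply, bracket_x, bracket_y, bracket_z, Complex.zero_re,
      Complex.zero_im, Complex.mul_re, Complex.sub_re, Complex.sub_im, Complex.mul_im]
    ring
  nondegenerate u hu := by
    have h1 := hu (mk 1 0 0)
    have h2 := hu (mk Complex.I 0 0)
    have h3 := hu (mk 0 1 0)
    have h4 := hu (mk 0 Complex.I 0)
    have h5 := hu (mk 0 0 1)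
    have h6 := hu (mk 0 0 Complex.I)
    rw [symplecticForm_apply] at h1 h2 h3 h4 h5 h6
    simp [mk_x, mk_y, mk_z] at h1 h2 h3 h4 h5 h6
    rw [ext_iff_coords]
    exact ⟨Complex.ext h5 h6, Complex.ext h4 h3, Complex.ext h1 h2⟩

end ComplexHeisenbergAlgebra

/-! ### Invariance of type H under isomorphism -/

section Transport

variable {L L' : Type*} [LieRing L] [LieAlgebra ℝ L] [LieRing L'] [LieAlgebra ℝ L']

theorem LieEquiv.map_lie_apply (e : L ≃ₗ⁅ℝ⁆ L') (x y : L) : e ⁅x, y⁆ = ⁅e x, e y⁆ :=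
  e.toLieHom.map_lie x y

theorem LieEquiv.map_zero_apply (e : L ≃ₗ⁅ℝ⁆ L') : e 0 = 0 :=
  e.toLieHom.map_zero

theorem LieEquiv.mem_center_iff (e : L ≃ₗ⁅ℝ⁆ L') (x : L) :
    e x ∈ LieAlgebra.center ℝ L' ↔ x ∈ LieAlgebra.center ℝ L := by
  simp only [LieModule.mem_maxTrivSubmodule]
  constructor
  · intro h y
    refine e.injective ?_
    change e _ = e _
    rw [LieEquiv.map_lie_apply, h, LieEquiv.map_zero_apply]
  · intro h y
    rw [← e.apply_symm_apply y, ← LieEquiv.map_lie_apply, h, LieEquiv.map_zero_apply]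

theorem IsTypeH.of_lieEquiv (e : L ≃ₗ⁅ℝ⁆ L') (h : IsTypeH L') : IsTypeH L := by
  obtain ⟨h2, hab, B, hB, hj⟩ := h
  let B' : LinearMap.BilinForm ℝ L := B.compl₁₂ (e : L →ₗ[ℝ] L') (e : L →ₗ[ℝ] L')
  have hB' : ∀ x y, B' x y = B (e x) (e y) := fun _ _ => rfl
  have hmem : ∀ x, x ∈ orthCenter B' ↔ e x ∈ orthCenter B := by
    intro x
    simp only [orthCenter, LinearMap.BilinForm.mem_orthogonal_iff]
    constructor
    · intro hx y hy
      have := hx (e.symm y) ((LieEquiv.mem_center_iff e _).1 (by simpa using hy))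
      rwa [hB', e.apply_symm_apply] at this
    · intro hx y hy
      exact hx (e y) ((LieEquiv.mem_center_iff e _).2 hy)
  let F : orthCenter B' →ₗ[ℝ] orthCenter B := (e : L →ₗ[ℝ] L').restrict fun x hx => (hmem x).1 hx
  let G : orthCenter B →ₗ[ℝ] orthCenter B' := (e.symm : L' →ₗ[ℝ] L).restrict fun x hx =>
    (hmem _).2 (by simpa using hx)
  have hG : ∀ x, (G x : L) = e.symm x := fun _ => rfl
  refine ⟨fun U V W => ?_, fun h => hab ?_, B', ⟨fun x y => hB.1 _ _, fun x hx => hB.2 _ ?_⟩,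
    fun Z hZ h1 => ?_⟩
  · refine e.injective ?_
    change e _ = e _
    rw [LieEquiv.map_lie_apply, LieEquiv.map_lie_apply, h2, LieEquiv.map_zero_apply]
  · refine ⟨fun x y => ?_⟩
    refine e.symm.injective ?_
    change e.symm _ = e.symm _
    rw [LieEquiv.map_lie_apply, h.trivial, LieEquiv.map_zero_apply]
  · intro h0
    exact hx (e.injective (h0.trans (LieEquiv.map_zero_apply e).symm))
  · obtain ⟨J, hJ, hO⟩ := hj (e Z) ((LieEquiv.mem_center_iff e _).2 hZ) h1
    refine ⟨G ∘ₗ J ∘ₗ F, fun V W => ?_, fun V W => ?_⟩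
    · have := hJ (F V) (F W)
      rw [hB', LieEquiv.map_lie_apply, hB', LinearMap.comp_apply, LinearMap.comp_apply, hG,
        e.apply_symm_apply]
      exact this
    · have := hO (F V) (F W)
      rw [hB', hB', LinearMap.comp_apply, LinearMap.comp_apply, hG, LinearMap.comp_apply,
        LinearMap.comp_apply, hG, e.apply_symm_apply, e.apply_symm_apply]
      exact this

end Transport

/-! ### Non-singular algebras with small center -/

section Nonsingular

variable {L : Type*} [LieRing L] [LieAlgebra ℝ L] [FiniteDimensional ℝ L]

theorem IsNonsingularLie.form_center_eq_zero (h2 : IsTwoStepNilpotent L) (hn : IsNonsingularLie L)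
    (hd : 3 * Module.finrank ℝ (LieAlgebra.center ℝ L) < Module.finrank ℝ L)
    (σ : L →ₗ[ℝ] L →ₗ[ℝ] ℝ) (halt : ∀ v, σ v v = 0)
    (hc : ∀ U V W, σ ⁅U, V⁆ W + σ ⁅V, W⁆ U + σ ⁅W, U⁆ V = 0)
    (Z : L) (hZ : Z ∈ LieAlgebra.center ℝ L) (U : L) : σ Z U = 0 := by
  set C := (LieAlgebra.center ℝ L).toSubmodule with hC
  have hcen : ∀ Z ∈ C, ∀ x : L, ⁅x, Z⁆ = 0 := fun Z hZ x =>
    (LieModule.mem_maxTrivSubmodule ℝ L L Z).1 hZ x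
  have hcen' : ∀ Z ∈ C, ∀ x : L, ⁅Z, x⁆ = 0 := fun Z hZ x => by
    rw [← lie_skew, hcen Z hZ, neg_zero]
  have hbr : ∀ x y : L, ⁅x, y⁆ ∈ C := fun x y => by
    refine (LieModule.mem_maxTrivSubmodule ℝ L L _).2 fun z => ?_
    rw [← lie_skew, h2, neg_zero]
  have hskew : ∀ x y, σ x y = - σ y x := fun x y => by
    have := halt (x + y)
    simp only [map_add, LinearMap.add_apply, halt] at this
    linarith
  have hd' : 3 * Module.finrank ℝ C < Module.finrank ℝ L := hd
  have hne : ∃ X, X ∉ C := by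
    by_contra! h
    have : C = ⊤ := Submodule.eq_top_iff'.2 h
    rw [this, finrank_top] at hd'
    omega
  -- The center is isotropic: with Z = [X, Y], the other two terms of the closedness identity
  -- contain a bracket with the central Z'.
  have hzz : ∀ Z ∈ C, ∀ Z' ∈ C, σ Z Z' = 0 := by
    obtain ⟨X, hX⟩ := hne
    intro Z hZ Z' hZ'
    obtain ⟨Y, rfl⟩ := hn X hX Z hZ
    have := hc X Y Z'
    rw [hcen Z' hZ', hcen' Z' hZ'] at this
    simpa using this
  -- a non-central vector commuting with `U` and orthogonal to the center
  let f : L →ₗ[ℝ] C := LinearMap.codRestrict C (LieAlgebra.ad ℝ L U) (fun y => hbr U y)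
  let g : L →ₗ[ℝ] Module.Dual ℝ C := (σ.flip).compl₂ C.subtype
  -- The target of `f.prod g` has dimension 2 dim 𝔷, so the kernel has dimension greater than dim 𝔷;
  -- it contains 𝔷 because 𝔷 is isotropic.
  have hk : C < LinearMap.ker (f.prod g) := by
    refine lt_of_le_of_ne ?_ ?_
    · intro z hz
      refine LinearMap.mem_ker.2 (Prod.ext (Subtype.ext (hcen z hz U)) ?_)
      ext z'
      exact hzz _ z'.2 _ hz
    · intro h
      have h1 := LinearMap.finrank_range_add_finrank_ker (f.prod g)
      have h2 := Submodule.finrank_le (LinearMap.range (f.prod g))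
      rw [Module.finrank_prod, Subspace.dual_finrank_eq] at h2
      rw [← h] at h1
      omega
  obtain ⟨V, hV, hVC⟩ := SetLike.exists_of_lt hk
  have hV1 : ⁅U, V⁆ = 0 := congrArg (fun p : C × Module.Dual ℝ C => (p.1 : L)) hV
  have hV2 : ∀ z ∈ C, σ z V = 0 := fun z hz =>
    congrArg (fun p : C × Module.Dual ℝ C => p.2 ⟨z, hz⟩) hV
  obtain ⟨W, rfl⟩ := hn V hVC Z hZ
  have := hc U V W
  rw [hV1, hV2 _ (hbr W U)] at this
  simpa using this

theorem IsNonsingularLie.not_isSymplecticForm (h2 : IsTwoStepNilpotent L)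
    (hn : IsNonsingularLie L)
    (hd : 3 * Module.finrank ℝ (LieAlgebra.center ℝ L) < Module.finrank ℝ L)
    (σ : L →ₗ[ℝ] L →ₗ[ℝ] ℝ) : ¬ IsSymplecticForm σ := by
  intro hσ
  have h0 : ∀ Z ∈ LieAlgebra.center ℝ L, Z = 0 := fun Z hZ => hσ.nondegenerate Z fun U =>
    hn.form_center_eq_zero h2 hd σ hσ.alternating hσ.closed Z hZ U
  have hbr : ∀ x y : L, ⁅x, y⁆ = 0 := fun x y => h0 _ <|
    (LieModule.mem_maxTrivSubmodule ℝ L L _).2 fun z => by rw [← lie_skew, h2, neg_zero]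
  have : Subsingleton L := subsingleton_of_forall_eq 0 fun x => h0 x <|
    (LieModule.mem_maxTrivSubmodule ℝ L L _).2 fun z => hbr z x
  rw [Module.finrank_zero_of_subsingleton (M := L)] at hd
  omega

end Nonsingular

/-! ### Parity of dimensions -/

section EvenDimension

/-- Taking determinants, det(J)² = (-1)ⁿ, which is negative for odd n. -/
theorem even_finrank_of_sq_eq_neg {V : Type*} [AddCommGroup V] [Module ℝ V]
    (J : V →ₗ[ℝ] V) (hJ : ∀ v, J (J v) = -v) : Even (Module.finrank ℝ V) := by
  have h1 : J ∘ₗ J = (-1 : ℝ) • LinearMap.id := by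
    ext v
    simp [hJ]
  have h2 := congrArg LinearMap.det h1
  rw [LinearMap.det_comp, LinearMap.det_smul, LinearMap.det_id, mul_one] at h2
  by_contra h
  rw [(Nat.not_even_iff_odd.1 h).neg_one_pow] at h2
  nlinarith [mul_self_nonneg (LinearMap.det J)]

/-- The Gram matrix A satisfies Aᵀ = -A, so det A = (-1)ⁿ det A with det A ≠ 0. -/
theorem even_finrank_of_alternating {V : Type*} [AddCommGroup V] [Module ℝ V]
    [FiniteDimensional ℝ V] (σ : V →ₗ[ℝ] V →ₗ[ℝ] ℝ) (halt : ∀ v, σ v v = 0)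
    (hnd : ∀ u, (∀ v, σ u v = 0) → u = 0) : Even (Module.finrank ℝ V) := by
  let b := Module.finBasis ℝ V
  let A : Matrix (Fin (Module.finrank ℝ V)) (Fin (Module.finrank ℝ V)) ℝ := LinearMap.toMatrix₂ b b σ
  have hA : A.transpose = -A := by
    ext i k
    have := halt (b i + b k)
    simp only [map_add, LinearMap.add_apply, halt] at this
    simp only [A, Matrix.transpose_apply, Matrix.neg_apply, LinearMap.toMatrix₂_apply]
    linarith
  have hdet : A.det ≠ 0 := by
    have : σ.SeparatingLeft := hnd
    exact (LinearMap.separatingLeft_iff_det_ne_zero b).1 this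
  have h := congrArg Matrix.det hA
  rw [Matrix.det_transpose, Matrix.det_neg, Fintype.card_fin] at h
  by_contra ho
  rw [(Nat.not_even_iff_odd.1 ho).neg_one_pow] at h
  exact hdet (by linarith)

end EvenDimension

/-! ### Clifford actions and closed pairings -/

section Clifford

open scoped InnerProductSpace

/-- Eigenvectors of a symmetric operator span; linear conditions on Z then need checking only on
them. -/
theorem LinearMap.IsSymmetric.eq_top_of_eigenvectors_mem {Z : Type*} [NormedAddCommGroup Z]
    [InnerProductSpace ℝ Z] [FiniteDimensional ℝ Z] {T : Z →ₗ[ℝ] Z} (hT : T.IsSymmetric)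
    (W : Submodule ℝ Z) (h : ∀ (c : ℝ) (z : Z), T z = c • z → z ∈ W) : W = ⊤ := by
  have hs := (hT.eigenvectorBasis rfl).toBasis.span_eq
  rw [eq_top_iff, ← hs, Submodule.span_le]
  rintro _ ⟨i, rfl⟩
  refine h (hT.eigenvalues rfl i) _ ?_
  simp

variable {V Z : Type*} [NormedAddCommGroup V] [InnerProductSpace ℝ V]
  [NormedAddCommGroup Z] [InnerProductSpace ℝ Z]

/-- Skew maps `j z` with `|j z v| = |z| |v|`. -/
structure IsCliffordAction (j : Z →ₗ[ℝ] V →ₗ[ℝ] V) : Prop where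
  inner_map_map : ∀ z v w, ⟪j z v, j z w⟫_ℝ = ⟪z, z⟫_ℝ * ⟪v, w⟫_ℝ
  skew : ∀ z v w, ⟪j z v, w⟫_ℝ = -⟪v, j z w⟫_ℝ

namespace IsCliffordAction

variable {j : Z →ₗ[ℝ] V →ₗ[ℝ] V}

theorem map_map_self (hj : IsCliffordAction j) (z : Z) (v : V) :
    j z (j z v) = -(⟪z, z⟫_ℝ • v) := by
  refine ext_inner_right ℝ fun w => ?_
  rw [hj.skew, hj.inner_map_map, inner_neg_left, real_inner_smul_left]

theorem map_map_add (hj : IsCliffordAction j) (z z' : Z) (v : V) :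
    j z (j z' v) + j z' (j z v) = -((2 * ⟪z, z'⟫_ℝ) • v) := by
  have h := hj.map_map_self (z + z') v
  simp only [map_add, LinearMap.add_apply, hj.map_map_self, inner_add_left, inner_add_right,
    real_inner_comm z z'] at h
  linear_combination (norm := module) h

theorem inner_map_map_self (hj : IsCliffordAction j) (z z' : Z) (v : V) :
    ⟪j z v, j z' v⟫_ℝ = ⟪z, z'⟫_ℝ * ⟪v, v⟫_ℝ := by
  have h := hj.inner_map_map (z + z') v v
  simp only [map_add, LinearMap.add_apply, hj.inner_map_map, inner_add_left, inner_add_right,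
    real_inner_comm z z', real_inner_comm (j z v) (j z' v)] at h
  linarith

theorem inner_map_self (hj : IsCliffordAction j) (z : Z) (v : V) : ⟪j z v, v⟫_ℝ = 0 := by
  have := hj.skew z v v
  rw [real_inner_comm] at this
  rw [real_inner_comm]
  linarith

/-- Skewness moves j(z₂) across, and anticommuting z₁ past z₂ costs only a multiple of u, which is
orthogonal to j(z₃)u. -/
theorem triple_cyclic (hj : IsCliffordAction j) (z₁ z₂ z₃ : Z) (u : V) :
    ⟪j z₂ (j z₃ u), j z₁ u⟫_ℝ = ⟪j z₁ (j z₂ u), j z₃ u⟫_ℝ := by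
  have h := congrArg (fun x => ⟪x, j z₃ u⟫_ℝ) (hj.map_map_add z₁ z₂ u)
  simp only [inner_add_left, inner_neg_left, real_inner_smul_left, real_inner_comm _ u,
    hj.inner_map_self] at h
  rw [hj.skew, real_inner_comm]
  linarith

theorem eq_zero_or_eq_zero (hj : IsCliffordAction j) {z : Z} {v : V} (h : j z v = 0) :
    z = 0 ∨ v = 0 := by
  have := hj.inner_map_map z v v
  rw [h, inner_zero_left, eq_comm, mul_eq_zero, inner_self_eq_zero, inner_self_eq_zero] at this
  exact this

theorem flip_injective (hj : IsCliffordAction j) {v : V} (hv : v ≠ 0) :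
    Function.Injective (j.flip v) := by
  rw [injective_iff_map_eq_zero]
  intro z hz
  exact (hj.eq_zero_or_eq_zero hz).resolve_right hv

/-- For v ≠ 0 the map z ↦ j(z)v is injective and its image is orthogonal to v, hence proper. -/
theorem finrank_lt (hj : IsCliffordAction j) [FiniteDimensional ℝ V] [Nontrivial V] :
    Module.finrank ℝ Z < Module.finrank ℝ V := by
  obtain ⟨v, hv⟩ := exists_ne (0 : V)
  rw [← LinearMap.finrank_range_of_inj (hj.flip_injective hv)]
  refine Submodule.finrank_lt (fun h => ?_)
  obtain ⟨z, hz⟩ := LinearMap.mem_range.1 (h ▸ Submodule.mem_top : v ∈ LinearMap.range (j.flip v))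
  have := hj.inner_map_self z v
  rw [LinearMap.flip_apply] at hz
  rw [hz, inner_self_eq_zero] at this
  exact hv this

theorem even_finrank (hj : IsCliffordAction j) [Nontrivial Z] : Even (Module.finrank ℝ V) := by
  obtain ⟨z, hz⟩ := exists_norm_eq Z zero_le_one
  refine even_finrank_of_sq_eq_neg (j z) fun v => ?_
  rw [hj.map_map_self, real_inner_self_eq_norm_sq, hz]
  simp

end IsCliffordAction

/-- The map `S` encodes a closed 2-form pairing the center `Z` with `V`. -/
structure IsClosedPairing (j : Z →ₗ[ℝ] V →ₗ[ℝ] V) (S : V →ₗ[ℝ] Z) : Prop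
    extends IsCliffordAction j where
  surjective : Function.Surjective S
  cyclic : ∀ u v w, ⟪j (S w) u, v⟫_ℝ + ⟪j (S u) v, w⟫_ℝ + ⟪j (S v) w, u⟫_ℝ = 0

namespace IsClosedPairing

variable {j : Z →ₗ[ℝ] V →ₗ[ℝ] V} {S : V →ₗ[ℝ] Z}

/-- One term of the cyclic identity vanishes, and skewness turns the other two into a symmetry. This
is what makes `shapeOperator` symmetric. -/
theorem inner_map_comm (h : IsClosedPairing j S) {u : V} (hu : S u = 0) (v w : V) :
    ⟪j (S w) u, v⟫_ℝ = ⟪j (S v) u, w⟫_ℝ := by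
  have := h.cyclic u v w
  rw [hu, h.skew (S v) w u, real_inner_comm _ w] at this
  simp only [map_zero, LinearMap.zero_apply, inner_zero_left] at this
  linarith

theorem map_mem_orthogonal (h : IsClosedPairing j S) {u : V} (hu : S u = 0) (z : Z) :
    j z u ∈ (LinearMap.ker S)ᗮ := by
  rw [Submodule.mem_orthogonal']
  intro v hv
  obtain ⟨w, rfl⟩ := h.surjective z
  rw [h.inner_map_comm hu, LinearMap.mem_ker.1 hv]
  simp

theorem finrank_ker [FiniteDimensional ℝ V] (h : IsClosedPairing j S) :
    Module.finrank ℝ Z + Module.finrank ℝ (LinearMap.ker S) = Module.finrank ℝ V := by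
  rw [← LinearMap.finrank_range_add_finrank_ker S, LinearMap.range_eq_top.2 h.surjective,
    finrank_top]

/-- One inclusion is `map_mem_orthogonal`; both sides have dimension dim Z. -/
theorem range_flip [FiniteDimensional ℝ V] (h : IsClosedPairing j S) {u : V} (hu : S u = 0) (hu0 : u ≠ 0) :
    LinearMap.range (j.flip u) = (LinearMap.ker S)ᗮ := by
  apply Submodule.eq_of_le_of_finrank_eq
  · rintro _ ⟨z, rfl⟩
    exact h.map_mem_orthogonal hu z
  · rw [LinearMap.finrank_range_of_inj (h.flip_injective hu0)]
    have h1 := h.finrank_ker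
    have h2 := Submodule.finrank_add_finrank_orthogonal (LinearMap.ker S)
    omega

end IsClosedPairing

/-- `R` is the right inverse of `S` with values in the orthogonal complement of the kernel. -/
structure IsOrthogonalSection (S : V →ₗ[ℝ] Z) (R : Z →ₗ[ℝ] V) : Prop where
  apply_apply : ∀ z, S (R z) = z
  mem_orthogonal : ∀ z, R z ∈ (LinearMap.ker S)ᗮ

theorem IsOrthogonalSection.eq_zero {S : V →ₗ[ℝ] Z} {R : Z →ₗ[ℝ] V}
    (hR : IsOrthogonalSection S R) {z : Z} (hz : R z = 0) : z = 0 := by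
  rw [← hR.apply_apply z, hz, map_zero]

theorem exists_isOrthogonalSection [FiniteDimensional ℝ V] {S : V →ₗ[ℝ] Z} (hS : Function.Surjective S) :
    ∃ R, IsOrthogonalSection S R := by
  obtain ⟨R₀, hR₀⟩ := LinearMap.exists_rightInverse_of_surjective S (LinearMap.range_eq_top.2 hS)
  refine ⟨R₀ - (LinearMap.ker S).starProjection.toLinearMap ∘ₗ R₀, fun z => ?_, fun z => ?_⟩
  · have h1 : S ((LinearMap.ker S).starProjection (R₀ z)) = 0 :=
      LinearMap.mem_ker.1 (Submodule.starProjection_apply_mem _ _)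
    have h2 : S (R₀ z) = z := LinearMap.congr_fun hR₀ z
    simp [h1, h2]
  · exact Submodule.sub_starProjection_mem_orthogonal _

variable [FiniteDimensional ℝ V] [FiniteDimensional ℝ Z]

/-- The operator `z ↦ R† (j z u)` on the center. -/
def shapeOperator (j : Z →ₗ[ℝ] V →ₗ[ℝ] V) (R : Z →ₗ[ℝ] V) : V →ₗ[ℝ] Z →ₗ[ℝ] Z :=
  j.flip.compr₂ (LinearMap.adjoint R)

namespace IsClosedPairing

variable {j : Z →ₗ[ℝ] V →ₗ[ℝ] V} {S : V →ₗ[ℝ] Z} {R : Z →ₗ[ℝ] V}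

theorem inner_shapeOperator (u : V) (z z' : Z) :
    ⟪shapeOperator j R u z, z'⟫_ℝ = ⟪j z u, R z'⟫_ℝ := by
  rw [shapeOperator, LinearMap.compr₂_apply, LinearMap.adjoint_inner_left, LinearMap.flip_apply]

theorem isSymmetric_shapeOperator (h : IsClosedPairing j S) (hR : IsOrthogonalSection S R) {u : V}
    (hu : S u = 0) : (shapeOperator j R u).IsSymmetric := by
  intro z z'
  rw [inner_shapeOperator, real_inner_comm _ z, inner_shapeOperator]
  have := h.inner_map_comm hu (R z') (R z)
  rwa [hR.apply_apply, hR.apply_apply] at this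

/-- By `range_flip`, R z = j(z₀)u for some z₀; symmetry of the shape operator identifies its value
at z as |u|² z₀. -/
theorem smul_section (h : IsClosedPairing j S) (hR : IsOrthogonalSection S R) {u : V}
    (hu : S u = 0) (z : Z) : ⟪u, u⟫_ℝ • R z = j (shapeOperator j R u z) u := by
  by_cases hu0 : u = 0
  · simp [hu0]
  obtain ⟨z₀, hz₀⟩ := LinearMap.mem_range.1 ((h.range_flip hu hu0).symm ▸ hR.mem_orthogonal z)
  rw [LinearMap.flip_apply] at hz₀
  have : shapeOperator j R u z = ⟪u, u⟫_ℝ • z₀ := by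
    refine ext_inner_right ℝ fun z' => ?_
    rw [h.isSymmetric_shapeOperator hR hu, real_inner_comm, inner_shapeOperator, ← hz₀,
      h.inner_map_map_self, real_inner_smul_left, real_inner_comm z₀]
    ring
  rw [this, ← hz₀, map_smul, LinearMap.smul_apply]

theorem shapeOperator_sq (h : IsClosedPairing j S) (hR : IsOrthogonalSection S R) {u : V}
    (hu : S u = 0) (z : Z) : shapeOperator j R u (shapeOperator j R u z) =
      ⟪u, u⟫_ℝ • LinearMap.adjoint R (R z) := by
  rw [← map_smul, h.smul_section hR hu]
  rfl

/-- Polarization of `shapeOperator_sq`: the square depends on u only through |u|². -/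
theorem shapeOperator_anticomm (h : IsClosedPairing j S) (hR : IsOrthogonalSection S R) {u v : V}
    (hu : S u = 0) (hv : S v = 0) (huv : ⟪u, v⟫_ℝ = 0) (z : Z) :
    shapeOperator j R u (shapeOperator j R v z) = -shapeOperator j R v (shapeOperator j R u z) := by
  have := h.shapeOperator_sq hR (u := u + v) (by rw [map_add, hu, hv, add_zero]) z
  simp only [map_add, LinearMap.add_apply, h.shapeOperator_sq hR hu, h.shapeOperator_sq hR hv,
    inner_add_left, inner_add_right, huv, real_inner_comm u v] at this
  linear_combination (norm := module) this

theorem eq_zero_or_of_shapeOperator_eq_zero (h : IsClosedPairing j S)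
    (hR : IsOrthogonalSection S R) {u : V} (hu : S u = 0) {z : Z} (hz : shapeOperator j R u z = 0) :
    u = 0 ∨ z = 0 := by
  have := h.smul_section hR hu z
  rw [hz, map_zero, LinearMap.zero_apply, smul_eq_zero, inner_self_eq_zero] at this
  exact this.imp_right (hR.eq_zero)

theorem section_of_eigenvector (h : IsClosedPairing j S) (hR : IsOrthogonalSection S R) {u : V}
    (hu : S u = 0) (hu1 : ⟪u, u⟫_ℝ = 1) {z : Z} {a : ℝ} (hz : shapeOperator j R u z = a • z) :
    R z = a • j z u := by
  have := h.smul_section hR hu z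
  rwa [hu1, one_smul, hz, map_smul, LinearMap.smul_apply] at this

/-- The cyclic identity is applied to R zᵢ = aᵢ j(zᵢ)u; by `triple_cyclic` its three terms share the
same inner product. -/
theorem triple_eigenvectors (h : IsClosedPairing j S) (hR : IsOrthogonalSection S R) {u : V}
    (hu : S u = 0) (hu1 : ⟪u, u⟫_ℝ = 1) {z₁ z₂ z₃ : Z} {a₁ a₂ a₃ : ℝ}
    (h₁ : shapeOperator j R u z₁ = a₁ • z₁) (h₂ : shapeOperator j R u z₂ = a₂ • z₂)
    (h₃ : shapeOperator j R u z₃ = a₃ • z₃) :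
    (a₁ * a₂ + a₃ * (a₁ + a₂)) * ⟪j z₁ (j z₂ u), j z₃ u⟫_ℝ = 0 := by
  have := h.cyclic (R z₂) (R z₃) (R z₁)
  simp only [hR.apply_apply] at this
  rw [h.section_of_eigenvector hR hu hu1 h₁, h.section_of_eigenvector hR hu hu1 h₂,
    h.section_of_eigenvector hR hu hu1 h₃] at this
  simp only [map_smul, real_inner_smul_left, real_inner_smul_right] at this
  rw [h.triple_cyclic z₁ z₂ z₃, ← h.triple_cyclic z₃ z₁ z₂] at this
  linarith

/-- By `triple_eigenvectors` the vector is orthogonal to j(z)u for every eigenvector z, hence to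
j(Z)u = Kᗮ, where K = ker S. -/
theorem map_map_mem_ker (h : IsClosedPairing j S) (hR : IsOrthogonalSection S R) {u : V}
    (hu : S u = 0) (hu1 : ⟪u, u⟫_ℝ = 1) {z₁ z₂ : Z} {a₁ a₂ : ℝ}
    (h₁ : shapeOperator j R u z₁ = a₁ • z₁) (h₂ : shapeOperator j R u z₂ = a₂ • z₂)
    (hc : ∀ (c : ℝ) (z : Z), z ≠ 0 → shapeOperator j R u z = c • z → a₁ * a₂ + c * (a₁ + a₂) ≠ 0) :
    j z₁ (j z₂ u) ∈ LinearMap.ker S := by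
  have hu0 : u ≠ 0 := by
    rintro rfl
    simp at hu1
  rw [← Submodule.orthogonal_orthogonal (LinearMap.ker S), Submodule.mem_orthogonal',
    ← h.range_flip hu hu0]
  let φ : Z →ₗ[ℝ] ℝ := (innerₛₗ ℝ (j z₁ (j z₂ u))) ∘ₗ j.flip u
  have hφ : LinearMap.ker φ = ⊤ := by
    refine (h.isSymmetric_shapeOperator hR hu).eq_top_of_eigenvectors_mem _ fun c z hz => ?_
    by_cases hz0 : z = 0
    · rw [hz0]; exact Submodule.zero_mem _
    exact LinearMap.mem_ker.2 ((mul_eq_zero.1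
      (h.triple_eigenvectors hR hu hu1 h₁ h₂ hz)).resolve_left (hc c z hz0 hz))
  rintro _ ⟨z, rfl⟩
  have : z ∈ LinearMap.ker φ := hφ ▸ Submodule.mem_top
  exact this

theorem exists_min_eigenvalue (h : IsClosedPairing j S) (hR : IsOrthogonalSection S R)
    [Nontrivial Z] {u v : V} (hu : S u = 0) (hu0 : u ≠ 0) (hv : S v = 0) (hv0 : v ≠ 0)
    (huv : ⟪u, v⟫_ℝ = 0) : ∃ (a : ℝ) (z : Z), 0 < a ∧ z ≠ 0 ∧ shapeOperator j R u z = a • z ∧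
      ∀ (c : ℝ) (z : Z), z ≠ 0 → shapeOperator j R u z = c • z → a ≤ |c| := by
  have hT := h.isSymmetric_shapeOperator hR hu
  have : Nonempty (Fin (Module.finrank ℝ Z)) := ⟨⟨0, Module.finrank_pos⟩⟩
  obtain ⟨i, hi⟩ := Finite.exists_min fun i => |hT.eigenvalues rfl i|
  have hmin : ∀ (c : ℝ) (z : Z), z ≠ 0 → shapeOperator j R u z = c • z →
      |hT.eigenvalues rfl i| ≤ |c| := by
    intro c z hz hc
    have : Module.End.HasEigenvalue (shapeOperator j R u) c :=
      Module.End.hasEigenvalue_of_hasEigenvector (x := z)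
        ⟨Module.End.mem_eigenspace_iff.2 hc, hz⟩
    obtain ⟨i', hi'⟩ := hT.exists_eigenvalues_eq rfl this
    have h1 : hT.eigenvalues rfl i' = c := hi'
    exact h1 ▸ hi i'
  set a := hT.eigenvalues rfl i
  set z := hT.eigenvectorBasis rfl i
  have hz : shapeOperator j R u z = a • z := hT.apply_eigenvectorBasis rfl i
  have hz0 : z ≠ 0 := (hT.eigenvectorBasis rfl).orthonormal.ne_zero i
  have ha0 : a ≠ 0 := by
    intro ha
    rw [ha, zero_smul] at hz
    exact (h.eq_zero_or_of_shapeOperator_eq_zero hR hu hz).elim hu0 hz0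
  rcases lt_or_gt_of_ne ha0 with ha | ha
  -- Anticommutation with the operator of v carries the a-eigenspace to the (-a)-eigenspace, so the
  -- sign can be made positive.
  · refine ⟨-a, shapeOperator j R v z, by linarith, fun h0 => ?_, ?_, ?_⟩
    · exact (h.eq_zero_or_of_shapeOperator_eq_zero hR hv h0).elim hv0 hz0
    · rw [h.shapeOperator_anticomm hR hu hv huv, hz, map_smul, neg_smul]
    · rwa [abs_of_neg ha] at hmin
  · refine ⟨a, z, ha, hz0, hz, ?_⟩
    rwa [abs_of_pos ha] at hmin

theorem finrank_of_even (h : IsClosedPairing j S) [Nontrivial V] [Nontrivial Z]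
    (heven : Even (Module.finrank ℝ V + Module.finrank ℝ Z)) :
    Module.finrank ℝ Z = 2 ∧ Module.finrank ℝ V = 4 := by
  obtain ⟨R, hR⟩ := exists_isOrthogonalSection h.surjective
  set K := LinearMap.ker S with hK
  have hkp := h.finrank_ker
  rw [← hK] at hkp
  have hlt := h.toIsCliffordAction.finrank_lt
  have hev := h.toIsCliffordAction.even_finrank
  -- dim K = dim V - dim Z is positive, and both dimensions are even.
  have hp2 : 2 ≤ Module.finrank ℝ K := by
    have := (Nat.even_add.1 heven).1 hev
    obtain ⟨m, hm⟩ := this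
    obtain ⟨n, hn⟩ := hev
    omega
  have : Nontrivial K := Module.finrank_pos_iff.1 (by omega : 0 < Module.finrank ℝ K)
  obtain ⟨⟨u, hu⟩, hu1⟩ := exists_norm_eq K zero_le_one
  have hu1' : ⟪u, u⟫_ℝ = 1 := by
    rw [real_inner_self_eq_norm_sq]
    have : ‖u‖ = 1 := hu1
    rw [this, one_pow]
  have hu0 : u ≠ 0 := by
    rintro rfl
    simp at hu1'
  rw [hK, LinearMap.mem_ker] at hu
  let K' : Submodule ℝ K := LinearMap.ker (innerₛₗ ℝ u ∘ₗ K.subtype)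
  have hK' : Module.finrank ℝ K ≤ Module.finrank ℝ K' + 1 := by
    have h1 := LinearMap.finrank_range_add_finrank_ker (innerₛₗ ℝ u ∘ₗ K.subtype)
    have h2 := Submodule.finrank_le (LinearMap.range (innerₛₗ ℝ u ∘ₗ K.subtype))
    rw [Module.finrank_self] at h2
    change _ + Module.finrank ℝ K' = _ at h1
    omega
  have hK'S : ∀ w : K', S (w : K) = 0 := fun w => LinearMap.mem_ker.1 (w : K).2
  have hK'u : ∀ w : K', ⟪u, ((w : K) : V)⟫_ℝ = 0 := fun w => LinearMap.mem_ker.1 w.2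
  have : Nontrivial K' := Module.finrank_pos_iff.1 (by omega : 0 < Module.finrank ℝ K')
  obtain ⟨v', hv'⟩ := exists_ne (0 : K')
  obtain ⟨v, hv, hv0, huv⟩ : ∃ v : V, S v = 0 ∧ v ≠ 0 ∧ ⟪u, v⟫_ℝ = 0 :=
    ⟨_, hK'S v', fun h0 => hv' (Subtype.ext (Subtype.ext h0)), hK'u v'⟩
  obtain ⟨a, z₁, ha, hz₁, hPz₁, hmin⟩ := h.exists_min_eigenvalue hR hu hu0 hv hv0 huv
  set P := shapeOperator j R u with hP
  set P' := shapeOperator j R v with hP'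
  have hswap : ∀ (c : ℝ) (z : Z), P z = c • z → P (P' z) = (-c) • P' z := fun c z hz => by
    rw [h.shapeOperator_anticomm hR hu hv huv, ← hP, ← hP', hz, map_smul, neg_smul]
  have hP'inj : Function.Injective P' := by
    rw [injective_iff_map_eq_zero]
    intro z hz
    exact (h.eq_zero_or_of_shapeOperator_eq_zero hR hv hz).resolve_left hv0
  set Ep := Module.End.eigenspace P a with hEp
  set Em := Module.End.eigenspace P (-a) with hEm
  -- For w in K orthogonal to u, the operator of w sends z₁ into the (-a)-eigenspace, injectively in
  -- w.
  have hdimm : Module.finrank ℝ K' ≤ Module.finrank ℝ Em := by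
    let f : K' →ₗ[ℝ] Em := LinearMap.codRestrict Em
      ((shapeOperator j R).flip z₁ ∘ₗ K.subtype ∘ₗ K'.subtype) fun w => by
        rw [hEm, Module.End.mem_eigenspace_iff]
        change P (shapeOperator j R (w : K) z₁) = -a • shapeOperator j R (w : K) z₁
        rw [h.shapeOperator_anticomm hR hu (hK'S w) (hK'u w), ← hP, hPz₁, map_smul, neg_smul]
    refine LinearMap.finrank_le_finrank_of_injective (f := f) ?_
    rw [injective_iff_map_eq_zero]
    intro w hw
    have hw' : shapeOperator j R (w : K) z₁ = 0 := congrArg Subtype.val hw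
    exact Subtype.ext (Subtype.ext
      ((h.eq_zero_or_of_shapeOperator_eq_zero hR (hK'S w) hw').resolve_right hz₁))
  have hdimp : Module.finrank ℝ Em ≤ Module.finrank ℝ Ep := by
    refine LinearMap.finrank_le_finrank_of_injective (f := P'.restrict fun z hz => ?_) ?_
    · rw [hEp, Module.End.mem_eigenspace_iff]
      rw [hEm, Module.End.mem_eigenspace_iff] at hz
      rw [hswap _ _ hz, neg_neg]
    · intro x y hxy
      exact Subtype.ext (hP'inj (congrArg Subtype.val hxy))
  have hsup : Module.finrank ℝ (Ep ⊔ Em : Submodule ℝ Z) =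
      Module.finrank ℝ Ep + Module.finrank ℝ Em := by
    have h1 := Submodule.finrank_sup_add_finrank_inf_eq Ep Em
    have h2 : Ep ⊓ Em = ⊥ := by
      rw [Submodule.eq_bot_iff]
      rintro z ⟨hz1, hz2⟩
      have h3 := (Module.End.mem_eigenspace_iff.1 hz1).symm.trans (Module.End.mem_eigenspace_iff.1 hz2)
      have h4 : (2 * a) • z = 0 := by linear_combination (norm := module) h3
      exact (smul_eq_zero.1 h4).resolve_left (by linarith)
    rw [h2, finrank_bot] at h1
    exact h1
  -- Y consists of the z with j(z₁)j(z)u in K; since z ↦ j(z₁)j(z)u is injective, dim Y ≤ dim K.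
  let Y : Submodule ℝ Z := K.comap (j z₁ ∘ₗ j.flip u)
  have hY : Module.finrank ℝ Y ≤ Module.finrank ℝ K := by
    refine LinearMap.finrank_le_finrank_of_injective
      (f := (j z₁ ∘ₗ j.flip u).restrict (p := Y) (q := K) fun z hz => hz) ?_
    rw [injective_iff_map_eq_zero]
    intro z hz
    have hz' : j z₁ (j (z : Z) u) = 0 := congrArg Subtype.val hz
    have := (h.eq_zero_or_eq_zero hz').resolve_left hz₁
    exact Subtype.ext ((h.eq_zero_or_eq_zero this).resolve_right hu0)
  have hYP : Module.finrank ℝ (Y.comap P') ≤ Module.finrank ℝ Y := by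
    refine LinearMap.finrank_le_finrank_of_injective
      (f := P'.restrict (p := Y.comap P') (q := Y) fun z hz => hz) ?_
    intro x y hxy
    exact Subtype.ext (hP'inj (congrArg Subtype.val hxy))
  -- If ac + d(a + c) = 0, then |d| = ac/(a + c) < a, against the minimality of a.
  have hYpos : ∀ (c : ℝ) (z : Z), 0 < c → P z = c • z → z ∈ Y := by
    intro c z hc hz
    refine h.map_map_mem_ker hR hu hu1' hPz₁ hz fun d w hw hd h0 => ?_
    have h1 := hmin d w hw hd
    have hd0 : d < 0 := by
      by_contra! hd0
      nlinarith [mul_pos ha hc, mul_nonneg hd0 (add_pos ha hc).le]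
    rw [abs_of_neg hd0] at h1
    nlinarith [mul_pos ha ha]
  -- Here the two eigenvalues sum to zero, so the scalar is -a² for every d.
  have hYneg : ∀ z : Z, P z = (-a) • z → z ∈ Y := by
    intro z hz
    refine h.map_map_mem_ker hR hu hu1' hPz₁ hz fun d w hw hd h0 => ?_
    nlinarith [mul_pos ha ha]
  have hEpY : Ep ≤ Y := fun z hz => hYpos a z ha (Module.End.mem_eigenspace_iff.1 hz)
  have hEmY : Em ≤ Y := fun z hz => hYneg z (Module.End.mem_eigenspace_iff.1 hz)
  have hinf : Ep ⊔ Em ≤ Y ⊓ Y.comap P' := by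
    refine le_inf (sup_le hEpY hEmY) (sup_le (fun z hz => ?_) fun z hz => ?_)
    · exact hYneg _ (hswap _ _ (Module.End.mem_eigenspace_iff.1 hz))
    · refine hYpos a _ ha ?_
      rw [hswap _ _ (Module.End.mem_eigenspace_iff.1 hz), neg_neg]
  -- Positive eigenvectors lie in Y, `P'` makes negative ones positive, and zero is not an
  -- eigenvalue.
  have htop : Y ⊔ Y.comap P' = ⊤ := by
    refine (h.isSymmetric_shapeOperator hR hu).eq_top_of_eigenvectors_mem _ fun c z hz => ?_
    rcases lt_trichotomy c 0 with hc | rfl | hc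
    · exact (le_sup_right : _ ≤ Y ⊔ Y.comap P') (hYpos (-c) _ (by linarith) (hswap _ _ hz))
    · rw [zero_smul] at hz
      rw [(h.eq_zero_or_of_shapeOperator_eq_zero hR hu hz).resolve_left hu0]
      exact Submodule.zero_mem _
    · exact (le_sup_left : _ ≤ Y ⊔ Y.comap P') (hYpos c z hc hz)
  -- With k = dim K, dim Z + 2(k - 1) ≤ 2k gives dim Z ≤ 2, while 2(k - 1) ≤ dim Z and k ≥ 2 force k
  -- = dim Z = 2.
  have hsum := Submodule.finrank_sup_add_finrank_inf_eq Y (Y.comap P')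
  rw [htop, finrank_top] at hsum
  have h1 := Submodule.finrank_mono hinf
  have h2 := Submodule.finrank_le (Ep ⊔ Em)
  omega

end IsClosedPairing

end Clifford

/-! ### Recognizing the complex Heisenberg bracket -/

section NormalForm

open scoped InnerProductSpace

variable {V Z : Type*} [NormedAddCommGroup V] [InnerProductSpace ℝ V] [FiniteDimensional ℝ V]
  [NormedAddCommGroup Z] [InnerProductSpace ℝ Z] [FiniteDimensional ℝ Z]

/-- For a unit u and an orthonormal basis z₁, z₂, the vectors u, j(z₁)u, j(z₂)u, j(z₁)j(z₂)u are an
orthonormal basis of V on which the Clifford relations fix the whole action. -/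
theorem IsCliffordAction.exists_heisenberg_equiv {j : Z →ₗ[ℝ] V →ₗ[ℝ] V} (hj : IsCliffordAction j)
    (β : V →ₗ[ℝ] V →ₗ[ℝ] Z) (hβ : ∀ z v w, ⟪z, β v w⟫_ℝ = ⟪j z v, w⟫_ℝ)
    (hZ : Module.finrank ℝ Z = 2) (hV : Module.finrank ℝ V = 4) :
    ∃ (φ : (ℂ × ℂ) ≃ₗ[ℝ] V) (ψ : ℂ ≃ₗ[ℝ] Z), ∀ a b, β (φ a) (φ b) = ψ (a.1 * b.2 - a.2 * b.1) := by
  have : Nontrivial V := Module.finrank_pos_iff.1 (by omega : 0 < Module.finrank ℝ V)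
  obtain ⟨u, hu⟩ := exists_norm_eq V zero_le_one
  have huu : ⟪u, u⟫_ℝ = 1 := by rw [real_inner_self_eq_norm_sq, hu, one_pow]
  let b : OrthonormalBasis (Fin 2) ℝ Z := (stdOrthonormalBasis ℝ Z).reindex (finCongr hZ)
  obtain ⟨z₁, hz₁⟩ : ∃ z, b 0 = z := ⟨_, rfl⟩
  obtain ⟨z₂, hz₂⟩ : ∃ z, b 1 = z := ⟨_, rfl⟩
  have h11 : ⟪z₁, z₁⟫_ℝ = 1 := by rw [← hz₁]; simp
  have h22 : ⟪z₂, z₂⟫_ℝ = 1 := by rw [← hz₂]; simp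
  have h12 : ⟪z₁, z₂⟫_ℝ = 0 := by rw [← hz₁, ← hz₂]; simp [b.inner_eq_ite]
  have h21 : ⟪z₂, z₁⟫_ℝ = 0 := by rw [real_inner_comm, h12]
  have hext : ∀ x y : Z, ⟪z₁, x⟫_ℝ = ⟪z₁, y⟫_ℝ → ⟪z₂, x⟫_ℝ = ⟪z₂, y⟫_ℝ → x = y := by
    intro x y h1 h2
    rw [← b.sum_repr' x, ← b.sum_repr' y, Fin.sum_univ_two, Fin.sum_univ_two, hz₁, hz₂, h1, h2]
  obtain ⟨e₂, he₂⟩ : ∃ e, j z₁ u = e := ⟨_, rfl⟩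
  obtain ⟨e₃, he₃⟩ : ∃ e, j z₂ u = e := ⟨_, rfl⟩
  obtain ⟨e₄, he₄⟩ : ∃ e, j z₁ e₃ = e := ⟨_, rfl⟩
  have a12 : j z₁ e₂ = -u := by rw [← he₂, hj.map_map_self, h11, one_smul]
  have a14 : j z₁ e₄ = -e₃ := by rw [← he₄, hj.map_map_self, h11, one_smul]
  have a23 : j z₂ e₃ = -u := by rw [← he₃, hj.map_map_self, h22, one_smul]
  have a22 : j z₂ e₂ = -e₄ := by
    have := hj.map_map_add z₁ z₂ u
    rw [h12, he₂, he₃, he₄, mul_zero, zero_smul, neg_zero] at this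
    exact eq_neg_of_add_eq_zero_right this
  have a24 : j z₂ e₄ = e₂ := by
    have := hj.map_map_self z₂ e₂
    rw [a22, h22, one_smul, map_neg] at this
    exact neg_injective this
  have i22 : ⟪e₂, e₂⟫_ℝ = 1 := by rw [← he₂, hj.inner_map_map, h11, huu, one_mul]
  have i33 : ⟪e₃, e₃⟫_ℝ = 1 := by rw [← he₃, hj.inner_map_map, h22, huu, one_mul]
  have i44 : ⟪e₄, e₄⟫_ℝ = 1 := by rw [← he₄, hj.inner_map_map, h11, i33, one_mul]
  have i21 : ⟪e₂, u⟫_ℝ = 0 := by rw [← he₂, hj.inner_map_self]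
  have i31 : ⟪e₃, u⟫_ℝ = 0 := by rw [← he₃, hj.inner_map_self]
  have i23 : ⟪e₂, e₃⟫_ℝ = 0 := by rw [← he₂, ← he₃, hj.inner_map_map_self, h12, zero_mul]
  have i41 : ⟪e₄, u⟫_ℝ = 0 := by
    rw [← he₄, hj.skew, he₂, real_inner_comm, i23, neg_zero]
  have i43 : ⟪e₄, e₃⟫_ℝ = 0 := by rw [← he₄, hj.inner_map_self]
  have i42 : ⟪e₄, e₂⟫_ℝ = 0 := by
    rw [← he₄, hj.skew, a12, inner_neg_right, neg_neg, i31]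
  have i12 : ⟪u, e₂⟫_ℝ = 0 := by rw [real_inner_comm, i21]
  have i13 : ⟪u, e₃⟫_ℝ = 0 := by rw [real_inner_comm, i31]
  have i14 : ⟪u, e₄⟫_ℝ = 0 := by rw [real_inner_comm, i41]
  have i32 : ⟪e₃, e₂⟫_ℝ = 0 := by rw [real_inner_comm, i23]
  have i34 : ⟪e₃, e₄⟫_ℝ = 0 := by rw [real_inner_comm, i43]
  have i24 : ⟪e₂, e₄⟫_ℝ = 0 := by rw [real_inner_comm, i42]
  -- The x-line is spanned by u, e₄ and the y-line by e₂, e₃. Then β(u, e₂) = z₁, β(u, e₃) = β(e₄,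
  -- e₂) = z₂ and β(e₄, e₃) = -z₁: complex multiplication with z₂ = i z₁.
  let φ : (ℂ × ℂ) →ₗ[ℝ] V :=
    { toFun := fun a => a.1.re • u + a.1.im • e₄ + a.2.re • e₂ + a.2.im • e₃
      map_add' := fun a b => by
        simp only [Prod.fst_add, Prod.snd_add, Complex.add_re, Complex.add_im]
        module
      map_smul' := fun t a => by
        simp only [Prod.smul_fst, Prod.smul_snd, Complex.smul_re, Complex.smul_im, smul_eq_mul,
          RingHom.id_apply]
        module }
  let ψ : ℂ →ₗ[ℝ] Z :=
    { toFun := fun a => a.re • z₁ + a.im • z₂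
      map_add' := fun a b => by
        simp only [Complex.add_re, Complex.add_im]
        module
      map_smul' := fun t a => by
        simp only [Complex.smul_re, Complex.smul_im, smul_eq_mul, RingHom.id_apply]
        module }
  have hφ : ∀ a, φ a = a.1.re • u + a.1.im • e₄ + a.2.re • e₂ + a.2.im • e₃ := fun _ => rfl
  have hψ : ∀ a, ψ a = a.re • z₁ + a.im • z₂ := fun _ => rfl
  have hφinj : Function.Injective φ := by
    rw [injective_iff_map_eq_zero]
    intro a ha
    have c1 := congrArg (fun x => ⟪u, x⟫_ℝ) ha
    have c2 := congrArg (fun x => ⟪e₂, x⟫_ℝ) ha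
    have c3 := congrArg (fun x => ⟪e₃, x⟫_ℝ) ha
    have c4 := congrArg (fun x => ⟪e₄, x⟫_ℝ) ha
    simp only [hφ, inner_add_right, real_inner_smul_right, huu, i22, i33, i44, i21, i31, i23, i41,
      i43, i42, i12, i13, i14, i32, i34, i24, inner_zero_right, mul_zero, mul_one, add_zero,
      zero_add] at c1 c2 c3 c4
    exact Prod.ext (Complex.ext c1 c4) (Complex.ext c2 c3)
  have hψinj : Function.Injective ψ := by
    rw [injective_iff_map_eq_zero]
    intro a ha
    have c1 := congrArg (fun x => ⟪z₁, x⟫_ℝ) ha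
    have c2 := congrArg (fun x => ⟪z₂, x⟫_ℝ) ha
    simp only [hψ, inner_add_right, real_inner_smul_right, h11, h22, h12, h21, inner_zero_right,
      mul_zero, mul_one, add_zero, zero_add] at c1 c2
    exact Complex.ext c1 c2
  refine ⟨LinearMap.linearEquivOfInjective φ hφinj (by simp [hV]),
    LinearMap.linearEquivOfInjective ψ hψinj (by simp [hZ]), fun a b => ?_⟩
  rw [LinearMap.linearEquivOfInjective_apply, LinearMap.linearEquivOfInjective_apply,
    LinearMap.linearEquivOfInjective_apply]
  refine hext _ _ ?_ ?_
  · rw [hβ]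
    simp only [hφ, hψ, map_add, map_smul, he₂, he₄, a12, a14, smul_neg, inner_add_right,
      inner_add_left, inner_neg_left, real_inner_smul_left, real_inner_smul_right, huu, i22, i33,
      i44, i21, i31, i23, i41, i43, i42, i12, i13, i14, i32, i34, i24, h11, h12, Complex.sub_re,
      Complex.mul_re]
    ring
  · rw [hβ]
    simp only [hφ, hψ, map_add, map_smul, he₃, a22, a23, a24, smul_neg, inner_add_right,
      inner_add_left, inner_neg_left, real_inner_smul_left, real_inner_smul_right, huu, i22, i33,
      i44, i21, i31, i23, i41, i43, i42, i12, i13, i14, i32, i34, i24, h22, h21, Complex.sub_im,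
      Complex.mul_im]
    ring

/-- A symplectic algebra of type H, given by its bracket `β : V × V → Z`, is the complex
Heisenberg algebra. -/
theorem exists_heisenberg_equiv_of_inner (β : V →ₗ[ℝ] V →ₗ[ℝ] Z) (halt : ∀ v, β v v = 0)
    (hne : β ≠ 0)
    (hH : ∀ z : Z, ⟪z, z⟫_ℝ = 1 → ∃ J : V →ₗ[ℝ] V, (∀ v w, ⟪z, β v w⟫_ℝ = ⟪J v, w⟫_ℝ) ∧
      ∀ v w, ⟪J v, J w⟫_ℝ = ⟪v, w⟫_ℝ)
    (γ : Z →ₗ[ℝ] V →ₗ[ℝ] ℝ) (hγ : ∀ z, (∀ v, γ z v = 0) → z = 0)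
    (hc : ∀ u v w, γ (β u v) w + γ (β v w) u + γ (β w u) v = 0)
    (heven : Even (Module.finrank ℝ V + Module.finrank ℝ Z)) :
    ∃ (φ : (ℂ × ℂ) ≃ₗ[ℝ] V) (ψ : ℂ ≃ₗ[ℝ] Z), ∀ a b, β (φ a) (φ b) = ψ (a.1 * b.2 - a.2 * b.1) := by
  obtain ⟨v₀, w₀, hvw⟩ : ∃ v w, β v w ≠ 0 := by
    by_contra! h
    exact hne (by ext v w; exact h v w)
  have : Nontrivial Z := ⟨_, _, hvw⟩
  have : Nontrivial V := ⟨v₀, 0, by rintro rfl; simp at hvw⟩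
  let j : Z →ₗ[ℝ] V →ₗ[ℝ] V := LinearMap.mk₂ ℝ (fun z v => LinearMap.adjoint (β v) z)
    (fun _ _ _ => map_add _ _ _) (fun _ _ _ => map_smul _ _ _)
    (fun z v w => by rw [map_add, map_add, LinearMap.add_apply])
    (fun t z v => by rw [map_smul, map_smulₛₗ, LinearMap.smul_apply]; rfl)
  have hβ : ∀ z v w, ⟪z, β v w⟫_ℝ = ⟪j z v, w⟫_ℝ := fun z v w =>
    (LinearMap.adjoint_inner_left (β v) w z).symm
  have hskewβ : ∀ v w, β v w = -β w v := fun v w => by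
    have := halt (v + w)
    simp only [map_add, LinearMap.add_apply, halt, zero_add, add_zero] at this
    exact eq_neg_of_add_eq_zero_left (by rw [add_comm]; exact this)
  have hj : IsCliffordAction j := by
    refine ⟨fun z v w => ?_, fun z v w => ?_⟩
    · by_cases hz : z = 0
      · simp [hz]
      · have hn : ‖z‖ ≠ 0 := norm_ne_zero_iff.2 hz
        obtain ⟨J, hJ, hO⟩ := hH (‖z‖⁻¹ • z) (by
          rw [real_inner_smul_left, real_inner_smul_right, real_inner_self_eq_norm_sq]
          field_simp)
        have hJj : ∀ v, j z v = ‖z‖ • J v := fun v => by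
          refine ext_inner_right ℝ fun w => ?_
          rw [← hβ, real_inner_smul_left, ← hJ, real_inner_smul_left, mul_inv_cancel_left₀ hn]
        rw [hJj, hJj, real_inner_smul_left, real_inner_smul_right, hO, real_inner_self_eq_norm_sq]
        ring
    · rw [← hβ, real_inner_comm _ v, ← hβ, hskewβ, inner_neg_right]
  -- S v is the Riesz representative of γ(·, v), so the orthogonal complement of its range is the
  -- left kernel of γ.
  let S : V →ₗ[ℝ] Z :=
    { toFun := fun v => LinearMap.adjoint (γ.flip v) (1 : ℝ)
      map_add' := fun v w => by rw [map_add, map_add, LinearMap.add_apply]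
      map_smul' := fun t v => by rw [map_smul, map_smulₛₗ, LinearMap.smul_apply]; rfl }
  have hS : ∀ v z, ⟪S v, z⟫_ℝ = γ z v := fun v z => by
    change ⟪LinearMap.adjoint (γ.flip v) (1 : ℝ), z⟫_ℝ = _
    rw [LinearMap.adjoint_inner_left]
    simp
  have h : IsClosedPairing j S := by
    refine ⟨hj, ?_, fun u v w => ?_⟩
    · rw [← LinearMap.range_eq_top, ← Submodule.orthogonal_eq_bot_iff, Submodule.eq_bot_iff]
      intro z hz
      refine hγ z fun v => ?_
      rw [← hS]
      exact (Submodule.mem_orthogonal _ _).1 hz _ ⟨v, rfl⟩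
    · rw [← hβ, ← hβ, ← hβ, hS, hS, hS]
      exact hc u v w
  obtain ⟨hZ, hV⟩ := h.finrank_of_even heven
  exact hj.exists_heisenberg_equiv β hβ hZ hV

end NormalForm

/-! ### From bilinear forms to inner product spaces -/

section Bilinear

variable {V Z : Type*} [AddCommGroup V] [Module ℝ V] [FiniteDimensional ℝ V]
  [AddCommGroup Z] [Module ℝ Z] [FiniteDimensional ℝ Z]

/-- The inner product space structure of a positive definite symmetric bilinear form. -/
@[reducible] def innerProductCore {F : Type*} [AddCommGroup F] [Module ℝ F]
    (B : LinearMap.BilinForm ℝ F) (hs : ∀ x y, B x y = B y x) (hp : ∀ x, x ≠ 0 → 0 < B x x) :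
    InnerProductSpace.Core ℝ F where
  inner x y := B x y
  conj_inner_symm x y := hs y x
  re_inner_nonneg x := by
    by_cases hx : x = 0
    · simp [hx]
    · exact (hp x hx).le
  add_left x y z := by rw [map_add, LinearMap.add_apply]
  smul_left x y r := by rw [map_smul, LinearMap.smul_apply]; rfl
  definite x hx := by
    by_contra h
    exact (hp x h).ne' hx

theorem exists_heisenberg_equiv_of_bilinForm (BV : LinearMap.BilinForm ℝ V)
    (hVs : ∀ x y, BV x y = BV y x) (hVp : ∀ x, x ≠ 0 → 0 < BV x x)
    (BZ : LinearMap.BilinForm ℝ Z)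
    (hZs : ∀ x y, BZ x y = BZ y x) (hZp : ∀ x, x ≠ 0 → 0 < BZ x x)
    (β : V →ₗ[ℝ] V →ₗ[ℝ] Z) (halt : ∀ v, β v v = 0)
    (hne : β ≠ 0)
    (hH : ∀ z : Z, BZ z z = 1 → ∃ J : V →ₗ[ℝ] V, (∀ v w, BZ z (β v w) = BV (J v) w) ∧
      ∀ v w, BV (J v) (J w) = BV v w)
    (γ : Z →ₗ[ℝ] V →ₗ[ℝ] ℝ) (hγ : ∀ z, (∀ v, γ z v = 0) → z = 0)
    (hc : ∀ u v w, γ (β u v) w + γ (β v w) u + γ (β w u) v = 0)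
    (heven : Even (Module.finrank ℝ V + Module.finrank ℝ Z)) :
    ∃ (φ : (ℂ × ℂ) ≃ₗ[ℝ] V) (ψ : ℂ ≃ₗ[ℝ] Z), ∀ a b, β (φ a) (φ b) = ψ (a.1 * b.2 - a.2 * b.1) := by
  let := innerProductCore BV hVs hVp
  let : NormedAddCommGroup V := InnerProductSpace.Core.toNormedAddCommGroup (𝕜 := ℝ)
  let : InnerProductSpace ℝ V := InnerProductSpace.ofCore _
  let := innerProductCore BZ hZs hZp
  let : NormedAddCommGroup Z := InnerProductSpace.Core.toNormedAddCommGroup (𝕜 := ℝ)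
  let : InnerProductSpace ℝ Z := InnerProductSpace.ofCore _
  exact exists_heisenberg_equiv_of_inner β halt hne hH γ hγ hc heven

end Bilinear

/-! ### Symplectic algebras of type H -/

section TypeH

variable {L : Type*} [LieRing L] [LieAlgebra ℝ L] [FiniteDimensional ℝ L]

theorem IsMetric.isCompl_orthogonal {B : LinearMap.BilinForm ℝ L} (hB : IsMetric B)
    (W : Submodule ℝ L) : IsCompl W (B.orthogonal W) := by
  refine (LinearMap.BilinForm.isCompl_orthogonal_iff_disjoint ?_).2 ?_
  · intro x y hxy
    rw [hB.1, hxy]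
  · rw [Submodule.disjoint_def]
    intro x hx hx'
    by_contra hx0
    exact (hB.2 x hx0).ne' ((LinearMap.BilinForm.mem_orthogonal_iff.1 hx') x hx)

theorem IsTypeH.lieEquiv_of_isSymplecticForm (h : IsTypeH L) {σ : L →ₗ[ℝ] L →ₗ[ℝ] ℝ}
    (hσ : IsSymplecticForm σ) : Nonempty (L ≃ₗ⁅ℝ⁆ ComplexHeisenbergAlgebra) := by
  obtain ⟨h2, hab, B, ⟨hBs, hBp⟩, hj⟩ := h
  set C := (LieAlgebra.center ℝ L).toSubmodule with hC
  set K := orthCenter B with hK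
  have hcen : ∀ Z ∈ C, ∀ x : L, ⁅x, Z⁆ = 0 := fun Z hZ x =>
    (LieModule.mem_maxTrivSubmodule ℝ L L Z).1 hZ x
  have hcen' : ∀ Z ∈ C, ∀ x : L, ⁅Z, x⁆ = 0 := fun Z hZ x => by
    rw [← lie_skew, hcen Z hZ, neg_zero]
  have hbr : ∀ x y : L, ⁅x, y⁆ ∈ C := fun x y => by
    refine (LieModule.mem_maxTrivSubmodule ℝ L L _).2 fun z => ?_
    rw [← lie_skew, h2, neg_zero]
  have hskew : ∀ x y, σ x y = - σ y x := fun x y => by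
    have := hσ.alternating (x + y)
    simp only [map_add, LinearMap.add_apply, hσ.alternating] at this
    linarith
  have hcompl : IsCompl C K := IsMetric.isCompl_orthogonal ⟨hBs, hBp⟩ C
  have hdec : ∀ x : L, ∃ z ∈ C, ∃ v ∈ K, z + v = x := fun x =>
    Submodule.mem_sup.1 (hcompl.sup_eq_top ▸ Submodule.mem_top : x ∈ C ⊔ K)
  let β : K →ₗ[ℝ] K →ₗ[ℝ] C := LinearMap.mk₂ ℝ (fun v w => ⟨⁅(v : L), (w : L)⁆, hbr v w⟩)
    (fun _ _ _ => Subtype.ext (add_lie _ _ _)) (fun _ _ _ => Subtype.ext (smul_lie _ _ _))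
    (fun _ _ _ => Subtype.ext (lie_add _ _ _)) (fun _ _ _ => Subtype.ext (lie_smul _ _ _))
  have hβ : ∀ v w, (β v w : L) = ⁅(v : L), (w : L)⁆ := fun _ _ => rfl
  have hbrdec : ∀ z ∈ C, ∀ z' ∈ C, ∀ v w : L, ⁅z + v, z' + w⁆ = ⁅v, w⁆ := by
    intro z hz z' hz' v w
    rw [add_lie, lie_add, lie_add, hcen' z hz, hcen' z hz, hcen z' hz', zero_add, zero_add,
      zero_add]
  have hne : β ≠ 0 := by
    intro h0
    refine hab ⟨fun x y => ?_⟩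
    obtain ⟨z, hz, v, hv, rfl⟩ := hdec x
    obtain ⟨z', hz', w, hw, rfl⟩ := hdec y
    rw [hbrdec z hz z' hz']
    exact congrArg Subtype.val (LinearMap.congr_fun (LinearMap.congr_fun h0 ⟨v, hv⟩) ⟨w, hw⟩)
  have hH : ∀ z : C, B z z = 1 → ∃ J : K →ₗ[ℝ] K, (∀ v w, B z (β v w) = B (J v) w) ∧
      ∀ v w, B (J v) (J w) = B v w := fun z hz => hj z z.2 hz
  obtain ⟨v₀, hv₀⟩ : ∃ v : K, v ≠ 0 := by
    by_contra! h0
    exact hne (by ext v w; rw [h0 v]; simp)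
  -- brackets exhaust the center
  have hzz : ∀ z ∈ C, ∀ z' ∈ C, σ z z' = 0 := by
    intro z hz z' hz'
    have hbz : ∀ x y : L, σ ⁅x, y⁆ z' = 0 := fun x y => by
      have := hσ.closed x y z'
      rw [hcen z' hz', hcen' z' hz'] at this
      simpa using this
    by_contra hzz'
    -- D contains all brackets by `hbz`. A nonzero central e ⟂ D would be orthogonal to [v₀, J v₀],
    -- whereas with J the map of e/|e|, ⟨e/|e|, [v₀, J v₀]⟩ = |J v₀|² = |v₀|² ≠ 0.
    let D : Submodule ℝ L := C ⊓ LinearMap.ker (σ.flip z')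
    have hD : D ⊔ B.orthogonal D = ⊤ := (IsMetric.isCompl_orthogonal ⟨hBs, hBp⟩ D).sup_eq_top
    obtain ⟨d, hd, e, he, rfl⟩ := Submodule.mem_sup.1 (hD ▸ Submodule.mem_top : z ∈ D ⊔ _)
    have he0 : e ≠ 0 := by
      rintro rfl
      rw [add_zero] at hzz'
      exact hzz' hd.2
    have heC : e ∈ C := (Submodule.add_mem_iff_right C hd.1).1 hz
    have hee := hBp e he0
    have hn : √(B e e) ≠ 0 := (Real.sqrt_pos.2 hee).ne'
    obtain ⟨J, hJ, hO⟩ := hH ⟨(√(B e e))⁻¹ • e, C.smul_mem _ heC⟩ (by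
      simp only [map_smul, LinearMap.smul_apply, smul_eq_mul]
      rw [← mul_assoc, ← mul_inv, Real.mul_self_sqrt hee.le, inv_mul_cancel₀ hee.ne'])
    have hJ0 : B (J v₀) (J v₀) = 0 := by
      rw [← hJ]
      have : B (β v₀ (J v₀)) e = 0 :=
        (LinearMap.BilinForm.mem_orthogonal_iff.1 he) _ ⟨(β v₀ (J v₀)).2, hbz _ _⟩
      rw [hBs] at this
      simp only [map_smul, LinearMap.smul_apply, this, smul_zero]
    rw [hO] at hJ0
    exact (hBp v₀ fun h0 => hv₀ (Subtype.ext h0)).ne' hJ0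
  let γ : C →ₗ[ℝ] K →ₗ[ℝ] ℝ := σ.compl₁₂ C.subtype K.subtype
  have hγ : ∀ z, (∀ v, γ z v = 0) → z = 0 := by
    intro z hz
    refine Subtype.ext (hσ.nondegenerate _ fun x => ?_)
    obtain ⟨z', hz', v, hv, rfl⟩ := hdec x
    rw [map_add, hzz z z.2 z' hz', zero_add]
    exact hz ⟨v, hv⟩
  have heven : Even (Module.finrank ℝ K + Module.finrank ℝ C) := by
    rw [add_comm, Submodule.finrank_add_eq_of_isCompl hcompl]
    exact even_finrank_of_alternating σ hσ.alternating hσ.nondegenerate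
  have hpos : ∀ (W : Submodule ℝ L) (x : W), x ≠ 0 → 0 < B x x := fun W x hx =>
    hBp x fun h0 => hx (Subtype.ext h0)
  obtain ⟨φ, ψ, hφψ⟩ := exists_heisenberg_equiv_of_bilinForm
    (B.compl₁₂ K.subtype K.subtype) (fun _ _ => hBs _ _) (hpos K)
    (B.compl₁₂ C.subtype C.subtype) (fun _ _ => hBs _ _) (hpos C) β
    (fun v => Subtype.ext (lie_self _)) hne hH γ hγ
    (fun u v w => hσ.closed u v w) heven
  let P := Submodule.prodEquivOfIsCompl C K hcompl
  let F : ComplexHeisenbergAlgebra ≃ₗ⁅ℝ⁆ L :=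
    { toFun := fun a => P (ψ a.2.2, φ (a.1, a.2.1))
      map_add' := fun a b => by
        rw [← map_add, Prod.mk_add_mk, ← map_add, ← map_add]
        rfl
      map_smul' := fun t a => by
        rw [RingHom.id_apply, ← map_smul, Prod.smul_mk, ← map_smul, ← map_smul]
        rfl
      map_lie' := fun {a b} => by
        have h1 : P (ψ (⁅a, b⁆).2.2, φ ((⁅a, b⁆).1, (⁅a, b⁆).2.1)) = (ψ (⁅a, b⁆).2.2 : L) := by
          rw [ComplexHeisenbergAlgebra.bracket_x, ComplexHeisenbergAlgebra.bracket_y,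
            Prod.mk_zero_zero, map_zero]
          simp [P]
        refine h1.trans ?_
        rw [ComplexHeisenbergAlgebra.bracket_z, ← hφψ (a.1, a.2.1) (b.1, b.2.1), hβ]
        exact (hbrdec _ (ψ a.2.2).2 _ (ψ b.2.2).2 _ _).symm
      invFun := fun x => ComplexHeisenbergAlgebra.mk (φ.symm (P.symm x).2).1 (φ.symm (P.symm x).2).2
        (ψ.symm (P.symm x).1)
      left_inv := fun a => by
        simp only [LinearEquiv.symm_apply_apply]
        rfl
      right_inv := fun x => by
        simp only [ComplexHeisenbergAlgebra.mk_x, ComplexHeisenbergAlgebra.mk_y,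
          ComplexHeisenbergAlgebra.mk_z, Prod.mk.eta, LinearEquiv.apply_symm_apply] }
  exact ⟨F.symm⟩

end TypeH

end

/-! ### The main theorem -/

theorem mainTheorem4
    (E : Type*) [NormedAddCommGroup E] [NormedSpace ℝ E] [FiniteDimensional ℝ E]
    (N : Type*) [TopologicalSpace N] [ChartedSpace E N] [Group N] [LieGroup 𝓘(ℝ, E) ∞ N] :
    -- non-singular 2-step nilpotent Lie groups with `dim 𝔫 > 3 dim 𝔷`
    (IsTwoStepNilpotent (GroupLieAlgebra 𝓘(ℝ, E) N) →
      IsNonsingularLie (GroupLieAlgebra 𝓘(ℝ, E) N) →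
      3 * Module.finrank ℝ (LieAlgebra.center ℝ (GroupLieAlgebra 𝓘(ℝ, E) N)) <
        Module.finrank ℝ (GroupLieAlgebra 𝓘(ℝ, E) N) →
      (∀ Ω : LeftInvariantTwoForm E N, Ω.IsClosed →
        ∀ Z ∈ LieAlgebra.center ℝ (GroupLieAlgebra 𝓘(ℝ, E) N),
          ∀ U : GroupLieAlgebra 𝓘(ℝ, E) N, Ω.form 1 Z U = 0) ∧
      ¬ AdmitsLeftInvariantSymplectic E N) ∧
    -- Lie groups of type H
    (IsTypeH (GroupLieAlgebra 𝓘(ℝ, E) N) →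
      (AdmitsLeftInvariantSymplectic E N ↔
        Nonempty (GroupLieAlgebra 𝓘(ℝ, E) N ≃ₗ⁅ℝ⁆ ComplexHeisenbergAlgebra))) ∧
    -- the complex Heisenberg group is of type H, has Lie algebra `𝔥(ℂ)`, and is symplectic
    (IsTypeH (GroupLieAlgebra 𝓘(ℝ, ℂ × ℂ × ℂ) ComplexHeisenbergGroup) ∧
      Nonempty (GroupLieAlgebra 𝓘(ℝ, ℂ × ℂ × ℂ) ComplexHeisenbergGroup ≃ₗ⁅ℝ⁆
        ComplexHeisenbergAlgebra) ∧
      AdmitsLeftInvariantSymplectic (ℂ × ℂ × ℂ) ComplexHeisenbergGroup) := by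
  have : FiniteDimensional ℝ (GroupLieAlgebra 𝓘(ℝ, E) N) := inferInstanceAs (FiniteDimensional ℝ E)
  refine ⟨fun h2 hn hd => ⟨fun Ω hΩ Z hZ U => ?_, fun h => ?_⟩, fun hH => ?_,
    IsTypeH.of_lieEquiv ComplexHeisenbergGroup.lieEquiv ComplexHeisenbergAlgebra.isTypeH,
    ⟨ComplexHeisenbergGroup.lieEquiv⟩, ?_⟩
  · exact hn.form_center_eq_zero (L := GroupLieAlgebra 𝓘(ℝ, E) N) h2 hd (Ω.form 1)
      (Ω.alternating 1) hΩ Z hZ U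
  · obtain ⟨σ, hσ⟩ := admitsLeftInvariantSymplectic_iff.1 h
    exact hn.not_isSymplecticForm h2 hd σ hσ
  · rw [admitsLeftInvariantSymplectic_iff]
    constructor
    · rintro ⟨σ, hσ⟩
      exact hH.lieEquiv_of_isSymplecticForm hσ
    · rintro ⟨e⟩
      exact ⟨_, ComplexHeisenbergAlgebra.isSymplecticForm_symplecticForm.comp e⟩
  · exact admitsLeftInvariantSymplectic_iff.2 ⟨_,
      ComplexHeisenbergAlgebra.isSymplecticForm_symplecticForm.comp
        ComplexHeisenbergGroup.lieEquiv⟩
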